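/- All manifolds are real, finite-dimensional, smooth, Hausdorff, paracompact and connected. Let $\pi:Y\to X$ be a smooth fibre bundle. For $k\ge 0$ let $J^kY$ be its manifold of $k$-jets of local sections ($J^0Y=Y$), with the coordinates $(x^\lambda,y^i_\Lambda)$, $0\le|\Lambda|\le k$, induced by a bundle coordinate chart $(x^\lambda,y^i)$ of $Y$. Let $J^\infty Y=\varprojlim_k J^kY$, with the projective limit topology and the projections $\pi^\infty_k:J^\infty Y\to J^kY$. Then $Y$ is a strong deformation retract of $J^\infty Y$. More precisely: (a) For each $k\ge 1$ the affine jet bundle $J^kY\to J^{k-1}Y$ has a smooth global section. There are smooth real functions $f_k$, $k\ge 1$, with $$f_k(t)=0 \ \text{ for } 0\le t\le 1-2^{-k},\qquad f_k(t)=1\ \text{ for } 1-2^{-(k+1)}\le t\le 1. \tag{1}$$ (b) For every choice of continuous (in particular, of smooth) global sections $\Gamma_{(k)}:J^{k-1}Y\to J^kY$, $k\ge 1$, there is a topological embedding $\gamma:Y\to J^\infty Y$ which is a global section of $\pi^\infty_0$ and satisfies $\pi^\infty_k\circ\gamma=\Gamma_{(k)}\circ\Gamma_{(k-1)}\circ\cdots\circ\Gamma_{(1)}$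 for all $k\geq 1$. For every choice of continuous functions $f_k:[0,1]\to\mathbb R$, $k\ge1$, with (1), there is a continuous map $H:[0,1]\times J^\infty Y\to J^\infty Y$ such that $$H(0,q)=\gamma(\pi^\infty_0(q)),\qquad H(1,q)=q,\qquad H(t,\gamma(y))=\gamma(y),\qquad \pi^\infty_0(H(t,q))=\pi^\infty_0(q)$$ for all $t\in[0,1]$, $q\in J^\infty Y$, $y\in Y$, and which in each bundle coordinate chart whose domain contains $\pi^\infty_0(q)$ is given by $$y^i_\Lambda(H(t,q))=f_k(t)\,y^i_\Lambda(q)+(1-f_k(t))\,y^i_\Lambda\bigl(\Gamma_{(k)}(\pi^\infty_{k-1}(H(t,q)))\bigr),\qquad |\Lambda|=k\ge 1 .$$ Thus $H$ moves the coordinates of order $k$ between the section values and their original values while $t$ runs through $[1-2^{-k},1-2^{-(k+1)}]$. -/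

import Mathlib

open Set Filter Topology
open scoped Manifold ContDiff unitInterval

noncomputable section

/-- `π : Y → X` is a smooth fibre bundle with typical fibre `F`: it is smooth, and locally over `X`
it is isomorphic, by a diffeomorphism over the base, to a product with `F`. -/
structure IsSmoothFibreBundle (EX EY EF : Type*)
    [NormedAddCommGroup EX] [NormedSpace ℝ EX] [NormedAddCommGroup EY] [NormedSpace ℝ EY]
    [NormedAddCommGroup EF] [NormedSpace ℝ EF]
    {X Y : Type*} (F : Type*) [TopologicalSpace X] [ChartedSpace EX X]
    [TopologicalSpace Y] [ChartedSpace EY Y] [TopologicalSpace F] [ChartedSpace EF F]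
    (π : Y → X) : Prop where
  contMDiff : ContMDiff 𝓘(ℝ, EY) 𝓘(ℝ, EX) ∞ π
  locally_trivial : ∀ x : X, ∃ e : Bundle.Trivialization F π, x ∈ e.baseSet ∧
    ContMDiffOn 𝓘(ℝ, EY) (𝓘(ℝ, EX).prod 𝓘(ℝ, EF)) ∞ e e.source ∧
    ContMDiffOn (𝓘(ℝ, EX).prod 𝓘(ℝ, EF)) 𝓘(ℝ, EY) ∞ e.toOpenPartialHomeomorph.symm e.target

/-- A bundle coordinate chart `(x^λ, y^i)` of `π : Y → X`: a smooth chart `base` of `X` with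
coordinates in `EX`, and a smooth chart `total` of `Y` with coordinates in `EX × EF`,
whose first component is the coordinate of the base point. -/
structure BundleChart (EX EY EF : Type*)
    [NormedAddCommGroup EX] [NormedSpace ℝ EX] [NormedAddCommGroup EY] [NormedSpace ℝ EY]
    [NormedAddCommGroup EF] [NormedSpace ℝ EF]
    {X Y : Type*} [TopologicalSpace X] [ChartedSpace EX X]
    [TopologicalSpace Y] [ChartedSpace EY Y] (π : Y → X) where
  base : OpenPartialHomeomorph X EX
  total : OpenPartialHomeomorph Y (EX × EF)
  base_smooth : ContMDiffOn 𝓘(ℝ, EX) 𝓘(ℝ, EX) ∞ base base.source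
  base_symm_smooth : ContMDiffOn 𝓘(ℝ, EX) 𝓘(ℝ, EX) ∞ base.symm base.target
  total_smooth : ContMDiffOn 𝓘(ℝ, EY) 𝓘(ℝ, EX × EF) ∞ total total.source
  total_symm_smooth : ContMDiffOn 𝓘(ℝ, EX × EF) 𝓘(ℝ, EY) ∞ total.symm total.target
  proj_mem : ∀ y ∈ total.source, π y ∈ base.source
  fst_eq : ∀ y ∈ total.source, (total y).1 = base (π y)

/-- A smooth local section of `π` defined near the point `pt`
(the values of `toFun` away from `pt` are irrelevant). -/
structure LocalSection (EX EY : Type*)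
    [NormedAddCommGroup EX] [NormedSpace ℝ EX] [NormedAddCommGroup EY] [NormedSpace ℝ EY]
    {X Y : Type*} [TopologicalSpace X] [ChartedSpace EX X]
    [TopologicalSpace Y] [ChartedSpace EY Y] (π : Y → X) where
  pt : X
  toFun : X → Y
  smooth : ∀ᶠ x in 𝓝 pt, ContMDiffAt 𝓘(ℝ, EX) 𝓘(ℝ, EY) ∞ toFun x
  isSection : ∀ᶠ x in 𝓝 pt, π (toFun x) = x

/-- The coordinate space of `k`-jets: a point `x ∈ EX` and, for each `m ≤ k`, an `m`-linear map
`EX^m → EF`, whose components in linear coordinates are the `y^i_Λ` with `|Λ| = m`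
(for `m = 0` it is the element `y` of `EF`). -/
abbrev JetCoord (EX EF : Type*) [NormedAddCommGroup EX] [NormedSpace ℝ EX]
    [NormedAddCommGroup EF] [NormedSpace ℝ EF] (k : ℕ) : Type _ :=
  EX × ((m : Fin (k + 1)) → ContinuousMultilinearMap ℝ (fun _ : Fin (m : ℕ) => EX) EF)

section

variable {EX EY EF : Type*}
  [NormedAddCommGroup EX] [NormedSpace ℝ EX] [NormedAddCommGroup EY] [NormedSpace ℝ EY]
  [NormedAddCommGroup EF] [NormedSpace ℝ EF]
  {X Y : Type*} [TopologicalSpace X] [ChartedSpace EX X]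
  [TopologicalSpace Y] [ChartedSpace EY Y] {π : Y → X}

/-- The value of a local section at its base point. -/
def LocalSection.val (s : LocalSection EX EY π) : Y := s.toFun s.pt

/-- The fibre part `y^i(x^λ)` of a local section in a bundle chart, as a function of the
base coordinates. -/
def LocalSection.rep (s : LocalSection EX EY π) (c : BundleChart EX EY EF π) : EX → EF :=
  fun z => (c.total (s.toFun (c.base.symm z))).2

open Classical in
/-- The coordinates of the `k`-jet of `s` at its base point in a bundle chart: the base coordinates
and the derivatives of orders `0, …, k` of the local representative.
Outside of the domain of the chart the value is set to be `0`. -/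
def LocalSection.jetCoord (s : LocalSection EX EY π) (c : BundleChart EX EY EF π) (k : ℕ) :
    JetCoord EX EF k :=
  if s.val ∈ c.total.source then
    (c.base s.pt, fun m => iteratedFDeriv ℝ (m : ℕ) (s.rep c) (c.base s.pt))
  else 0

/-- The coordinate domain that corresponds to a bundle chart: the coordinates of orders `≥ 1`
are unrestricted. -/
def BundleChart.jetTarget (c : BundleChart EX EY EF π) (k : ℕ) : Set (JetCoord EX EF k) :=
  {p | (p.1, p.2 0 (fun _ => 0)) ∈ c.total.target}

end

section

variable (EX EY EF : Type*)
  [NormedAddCommGroup EX] [NormedSpace ℝ EX] [NormedAddCommGroup EY] [NormedSpace ℝ EY]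
  [NormedAddCommGroup EF] [NormedSpace ℝ EF]
  {X Y : Type*} [TopologicalSpace X] [ChartedSpace EX X]
  [TopologicalSpace Y] [ChartedSpace EY Y] (π : Y → X)

/-- Two local sections have the same `k`-jet if they have the same base point, the same value there,
and the same derivatives up to order `k` there in bundle coordinates. -/
def jetSetoid (k : ℕ) : Setoid (LocalSection EX EY π) where
  r s s' := s.pt = s'.pt ∧ s.val = s'.val ∧
    ∀ c : BundleChart EX EY EF π, s.jetCoord c k = s'.jetCoord c k
  iseqv :=
    ⟨fun _ => ⟨rfl, rfl, fun _ => rfl⟩,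
     fun h => ⟨h.1.symm, h.2.1.symm, fun c => (h.2.2 c).symm⟩,
     fun h h' => ⟨h.1.trans h'.1, h.2.1.trans h'.2.1, fun c => (h.2.2 c).trans (h'.2.2 c)⟩⟩

/-- The jet space `J^k Y` of `k`-jets of local sections of `π : Y → X`. -/
def Jet (k : ℕ) : Type _ := Quotient (jetSetoid EX EY EF π k)

end

section

variable {EX EY EF : Type*}
  [NormedAddCommGroup EX] [NormedSpace ℝ EX] [NormedAddCommGroup EY] [NormedSpace ℝ EY]
  [NormedAddCommGroup EF] [NormedSpace ℝ EF]
  {X Y : Type*} [TopologicalSpace X] [ChartedSpace EX X]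
  [TopologicalSpace Y] [ChartedSpace EY Y] {π : Y → X}

/-- The projection `π^k_0 : J^k Y → Y`. -/
def Jet.eval {k : ℕ} : Jet EX EY EF π k → Y :=
  Quotient.lift (fun s : LocalSection EX EY π => s.val) (fun _ _ h => h.2.1)

/-- The jet coordinates `(x^λ, y^i_Λ)`, `0 ≤ |Λ| ≤ k`, on `J^k Y` that a bundle chart induces;
meaningful for jets whose value in `Y` is in the domain of the chart. -/
def Jet.coord {k : ℕ} (c : BundleChart EX EY EF π) : Jet EX EY EF π k → JetCoord EX EF k :=
  Quotient.lift (fun s : LocalSection EX EY π => s.jetCoord c k) (fun _ _ h => h.2.2 c)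

/-- The jet coordinates `y^i_Λ` of top order `|Λ| = k` on `J^k Y`. -/
def Jet.topCoord {k : ℕ} (c : BundleChart EX EY EF π) (j : Jet EX EY EF π k) :
    ContinuousMultilinearMap ℝ (fun _ : Fin k => EX) EF :=
  (j.coord c).2 (Fin.last k)

theorem LocalSection.jetCoord_of_succ {s s' : LocalSection EX EY π}
    {c : BundleChart EX EY EF π} {k : ℕ} (hv : s.val = s'.val)
    (h : s.jetCoord c (k + 1) = s'.jetCoord c (k + 1)) : s.jetCoord c k = s'.jetCoord c k := by
  unfold LocalSection.jetCoord at h ⊢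
  rw [← hv] at h ⊢
  by_cases hs : s.val ∈ c.total.source
  · simp only [if_pos hs] at h ⊢
    obtain ⟨h1, h2⟩ := Prod.mk.inj h
    exact Prod.ext h1 (funext fun m => congrFun h2 m.castSucc)
  · simp only [if_neg hs]

/-- The projection `π^{k+1}_k : J^{k+1} Y → J^k Y`. -/
def Jet.proj {k : ℕ} : Jet EX EY EF π (k + 1) → Jet EX EY EF π k :=
  Quotient.map' id
    (fun _ _ h => ⟨h.1, h.2.1, fun c => LocalSection.jetCoord_of_succ h.2.1 (h.2.2 c)⟩)

/-- The manifold topology of `J^k Y`, generated by the coordinate-open subsets of the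
coordinate domains of the bundle charts. -/
instance Jet.instTopologicalSpace {k : ℕ} : TopologicalSpace (Jet EX EY EF π k) :=
  TopologicalSpace.generateFrom
    {U | ∃ (c : BundleChart EX EY EF π) (W : Set (JetCoord EX EF k)), IsOpen W ∧
      U = {j | j.eval ∈ c.total.source ∧ j.coord c ∈ W}}

/-- `Γ` is a continuous global section of `J^{k+1} Y → J^k Y`. -/
structure IsContinuousJetSection {k : ℕ} (Γ : Jet EX EY EF π k → Jet EX EY EF π (k + 1)) :
    Prop where
  proj_apply : ∀ j, (Γ j).proj = j
  continuous : Continuous Γ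

/-- `Γ` is a smooth global section of `J^{k+1} Y → J^k Y`: in the jet coordinates of each bundle
chart it is given by a smooth map. (The values of the coordinates are symmetric multilinear maps;
a map on an open set of these is smooth if and only if it is the restriction of a smooth map.) -/
structure IsSmoothJetSection {k : ℕ} (Γ : Jet EX EY EF π k → Jet EX EY EF π (k + 1)) : Prop
    extends IsContinuousJetSection Γ where
  smooth_coord : ∀ c : BundleChart EX EY EF π,
    ∃ G : JetCoord EX EF k → JetCoord EX EF (k + 1), ContDiffOn ℝ ∞ G (c.jetTarget k) ∧
      ∀ j : Jet EX EY EF π k, j.eval ∈ c.total.source → (Γ j).coord c = G (j.coord c)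

end

section

variable (EX EY EF : Type*)
  [NormedAddCommGroup EX] [NormedSpace ℝ EX] [NormedAddCommGroup EY] [NormedSpace ℝ EY]
  [NormedAddCommGroup EF] [NormedSpace ℝ EF]
  {X Y : Type*} [TopologicalSpace X] [ChartedSpace EX X]
  [TopologicalSpace Y] [ChartedSpace EY Y] (π : Y → X)

/-- The infinite-order jet space `J^∞ Y`, the projective limit of the spaces `J^k Y` with the
projective limit topology. -/
abbrev JetInf : Type _ :=
  {q : (k : ℕ) → Jet EX EY EF π k // ∀ k, (q (k + 1)).proj = q k}

variable {EX EY EF π}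

/-- The projection `π^∞_0 : J^∞ Y → Y`. -/
def JetInf.eval (q : JetInf EX EY EF π) : Y := (q.1 0).eval

end

/-- The inclusion `i : A → Z`, the retraction `r : Z → A` and the homotopy `H` exhibit `A` as a
strong deformation retract of `Z`: `i` is an embedding, `r ∘ i = id`, and `H` is a homotopy
from `i ∘ r` to the identity of `Z` that is stationary on the image of `A`. -/
structure IsStrongDeformationRetract {A Z : Type*} [TopologicalSpace A] [TopologicalSpace Z]
    (i : A → Z) (r : Z → A) (H : I × Z → Z) : Prop where
  isEmbedding : IsEmbedding i
  continuous_retraction : Continuous r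
  retraction_apply : ∀ a, r (i a) = a
  continuous_homotopy : Continuous H
  homotopy_zero : ∀ z, H (0, z) = i (r z)
  homotopy_one : ∀ z, H (1, z) = z
  homotopy_fixed : ∀ t a, H (t, i a) = i a

/-- Continuous functions `f_k`, `k ≥ 1`, on `[0,1]` such that `f_k = 0` on `[0, 1 - 2^{-k}]` and
`f_k = 1` on `[1 - 2^{-(k+1)}, 1]`. -/
structure IsStepFamily (f : ℕ → ℝ → ℝ) : Prop where
  continuousOn : ∀ k, 1 ≤ k → ContinuousOn (f k) (Icc 0 1)
  eq_zero : ∀ k, 1 ≤ k → ∀ t ∈ Icc (0 : ℝ) 1, t ≤ 1 - (1 / 2) ^ k → f k t = 0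
  eq_one : ∀ k, 1 ≤ k → ∀ t ∈ Icc (0 : ℝ) 1, 1 - (1 / 2) ^ (k + 1) ≤ t → f k t = 1

end

/-! The fibres of J^{k+1}Y → J^kY carry affine combinations. A jet of order `k + 1` is determined by
its projection and its top coordinates in one chart (`Jet.ext_topCoord`), and a change of bundle
chart acts on the top coordinates, the lower ones being fixed, by an affine map. This is the chain
rule: the leading coefficient of a composite is linear in the outer series and affine in the leading
coefficient of the inner one (`taylorComp_sum_right`, `BundleChart.transition_sum`). Hence
combinations with weights of sum 1, formed on representatives in one chart, have the same formula in
every chart (`Jet.exists_affineCombination`). A partition of unity on Y then glues the chartwise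
sections with zero top coordinates into a smooth global one (`Jet.exists_isSmoothJetSection`).

The homotopy is built by recursion on the order: H_0 = q_0, and H_{k+1} is the combination of
q_{k+1} and Γ_k(H_k) with weights f_{k+1}(t) and 1 - f_{k+1}(t). The two jets must lie over the same
k-jet. If f_{k+1}(t) ≠ 0, then t is so large that f_1, …, f_k are all 1
(`IsStepFamily.eq_one_of_ne_zero`), so H_k = q_k and they do. If f_{k+1}(t) = 0, only Γ_k(H_k)
matters. The projective limit topology reduces continuity to each order, where it is read off from
the formula in one chart (`Jet.continuousAt_of_coord`). The end values come from all f_k being 0 at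
t = 0 and 1 at t = 1.

Jets are classes of actual local sections, so each jet needed must be realized by a function. For
zero top coordinates this is `exists_iteratedFDeriv_eq_zero`. -/

noncomputable section

/-! ### Taylor coefficients of composite maps -/

section TaylorComposition

variable {E F G : Type*} [NormedAddCommGroup E] [NormedSpace ℝ E]
  [NormedAddCommGroup F] [NormedSpace ℝ F] [NormedAddCommGroup G] [NormedSpace ℝ G]

theorem taylorComp_congr {q q' : FormalMultilinearSeries ℝ F G}
    {p p' : FormalMultilinearSeries ℝ E F} {n : ℕ}
    (hq : ∀ m ≤ n, q m = q' m) (hp : ∀ m ≤ n, p m = p' m) :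
    q.taylorComp p n = q'.taylorComp p' n := by
  refine Finset.sum_congr rfl fun c _ => ?_
  unfold FormalMultilinearSeries.compAlongOrderedFinpartition
  rw [hq _ c.length_le]
  congr 1
  exact funext fun i => hp _ (c.partSize_le i)

theorem taylorComp_zero_apply (q : FormalMultilinearSeries ℝ F G)
    (p : FormalMultilinearSeries ℝ E F) (v : Fin 0 → E) (w : Fin 0 → F) :
    q.taylorComp p 0 v = q 0 w := by
  unfold FormalMultilinearSeries.taylorComp
  rw [Fintype.sum_unique]
  change q 0 _ = q 0 w
  exact congrArg (q 0) (Subsingleton.elim _ _)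

/-- The coefficient of order `n` of a composition is linear in the outer series. -/
theorem taylorComp_sum_left {ι : Type*} (S : Finset ι) (a : ι → ℝ)
    {Q : FormalMultilinearSeries ℝ F G} {q : ι → FormalMultilinearSeries ℝ F G}
    (p : FormalMultilinearSeries ℝ E F) {n : ℕ}
    (hQ : ∀ m ≤ n, Q m = ∑ i ∈ S, a i • q i m) :
    Q.taylorComp p n = ∑ i ∈ S, a i • (q i).taylorComp p n := by
  simp only [FormalMultilinearSeries.taylorComp, Finset.smul_sum]
  rw [Finset.sum_comm]
  refine Finset.sum_congr rfl fun c _ => ?_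
  ext v
  simp [hQ _ c.length_le]

/-- The coefficient of order `n` of a composition is affine in the coefficient of order `n`
of the inner series. -/
theorem taylorComp_sum_right {ι : Type*} (S : Finset ι) (a : ι → ℝ) (ha : ∑ i ∈ S, a i = 1)
    (q : FormalMultilinearSeries ℝ F G)
    {P : FormalMultilinearSeries ℝ E F} {p : ι → FormalMultilinearSeries ℝ E F} {n : ℕ}
    (hn : 0 < n)
    (hlow : ∀ m < n, ∀ i ∈ S, p i m = P m) (htop : P n = ∑ i ∈ S, a i • p i n) :
    q.taylorComp P n = ∑ i ∈ S, a i • q.taylorComp (p i) n := by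
  simp only [FormalMultilinearSeries.taylorComp, Finset.smul_sum]
  rw [Finset.sum_comm]
  refine Finset.sum_congr rfl fun c _ => ?_
  unfold FormalMultilinearSeries.compAlongOrderedFinpartition
  simp only [← OrderedFinpartition.compAlongOrderedFinpartitionL_apply]
  set B := c.compAlongOrderedFinpartitionL ℝ E F G (q c.length)
  -- A block of size `n` exhausts `Fin n`, so its term is linear in the coefficient of order `n`. A
  -- partition without such a block sees only lower coefficients, and the weights sum to 1.
  by_cases h : ∃ i, c.partSize i = n
  · obtain ⟨i, hi⟩ := h
    have hj : ∀ j, j ≠ i → c.partSize j < n := by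
      intro j hji
      have h1 := c.sum_sigma_eq_sum (fun _ : Fin n => 1)
      simp only [Finset.sum_const, Finset.card_univ, Fintype.card_fin, smul_eq_mul, mul_one] at h1
      have h2 : c.partSize i + c.partSize j ≤ ∑ m, c.partSize m := by
        rw [← Finset.sum_pair hji.symm]
        exact Finset.sum_le_sum_of_subset (Finset.subset_univ _)
      have := c.partSize_pos i
      omega
    have e1 : ∀ k ∈ S, (fun m => p k (c.partSize m)) =
        Function.update (fun m => P (c.partSize m)) i (p k (c.partSize i)) := by
      intro k hk
      funext m
      by_cases hm : m = i
      · subst hm; simp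
      · rw [Function.update_of_ne hm]; exact hlow _ (hj m hm) k hk
    have e2 : (fun m => P (c.partSize m)) =
        Function.update (fun m => P (c.partSize m)) i (∑ k ∈ S, a k • p k (c.partSize i)) := by
      have : P (c.partSize i) = ∑ k ∈ S, a k • p k (c.partSize i) := by rw [hi, htop]
      rw [← this, Function.update_eq_self]
    rw [e2]
    have e3 := map_sum (B.toContinuousLinearMap (fun m => P (c.partSize m)) i)
      (fun k => a k • p k (c.partSize i)) S
    simp only [ContinuousMultilinearMap.toContinuousLinearMap_apply] at e3
    rw [e3]
    refine Finset.sum_congr rfl fun k hk => ?_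
    rw [e1 k hk, ContinuousMultilinearMap.map_update_smul]
  · push Not at h
    have e1 : ∀ k ∈ S, (fun m => p k (c.partSize m)) = fun m => P (c.partSize m) := fun k hk =>
      funext fun m => hlow _ (lt_of_le_of_ne (c.partSize_le m) (h m)) k hk
    rw [Finset.sum_congr rfl fun k hk => by rw [e1 k hk], ← Finset.sum_smul, ha, one_smul]

/-- Each summand is a continuous multilinear, hence analytic, function of finitely many coefficients
of the two series. -/
theorem ContDiffAt.taylorComp {Z : Type*} [NormedAddCommGroup Z] [NormedSpace ℝ Z] {r : WithTop ℕ∞}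
    {q : Z → FormalMultilinearSeries ℝ F G} {p : Z → FormalMultilinearSeries ℝ E F} {n : ℕ} {z : Z}
    (hq : ∀ m ≤ n, ContDiffAt ℝ r (fun w => q w m) z)
    (hp : ∀ m ≤ n, ContDiffAt ℝ r (fun w => p w m) z) :
    ContDiffAt ℝ r (fun w => (q w).taylorComp (p w) n) z := by
  refine ContDiffAt.sum fun c _ => ?_
  let B := c.compAlongOrderedFinpartitionL ℝ E F G
  have h2 : ContDiffAt ℝ r (fun w => (fun i => p w (c.partSize i))) z :=
    contDiffAt_pi.2 fun i => hp _ (c.partSize_le i)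
  have h3 := (B.analyticOnNhd_uncurry_of_multilinear (s := univ)).contDiffOn (n := r)
    uniqueDiffOn_univ
  exact ((contDiffOn_univ.1 h3).contDiffAt (x := (q z c.length, fun i => p z (c.partSize i)))).comp
    z ((hq _ c.length_le).prodMk h2)

end TaylorComposition

/-! ### Changing one derivative at a point -/

section KillTop

variable {E F : Type*} [NormedAddCommGroup E] [NormedSpace ℝ E]
  [NormedAddCommGroup F] [NormedSpace ℝ F]

/-- The homothety fixes `x` and has linear part `l`. For `l ≠ 0` it is invertible, so no
differentiability of `u` is needed. -/
theorem iteratedFDeriv_comp_homothety {l : ℝ} (hl : l ≠ 0) (u : E → F) (x : E) (n : ℕ) :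
    iteratedFDeriv ℝ n (fun z => u (x + l • (z - x))) x = l ^ n • iteratedFDeriv ℝ n u x := by
  have h1 := iteratedFDeriv_comp_sub (𝕜 := ℝ) (f := fun w => u (x + l • w)) n x x
  rw [h1, sub_self]
  let e : E ≃L[ℝ] E := ContinuousLinearEquiv.smulLeft (Units.mk0 l hl)
  have h2 := e.iteratedFDerivWithin_comp_right (𝕜 := ℝ) (fun w => u (x + w)) uniqueDiffOn_univ
    (x := 0) (mem_univ _) n
  simp only [preimage_univ, iteratedFDerivWithin_univ] at h2
  have h3 : ((fun w => u (x + w)) ∘ e) = fun w => u (x + l • w) := by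
    funext w; simp [e, Units.smul_def]
  rw [h3] at h2
  rw [h2, iteratedFDeriv_comp_add_left]
  ext v
  simp [e, Units.smul_def, ContinuousMultilinearMap.map_smul_univ]

/-- A Vandermonde system with the distinct nodes 1, …, n. Nodes start at 1 because they serve as
ratios of homotheties, which must be nonzero. -/
theorem exists_moments (n : ℕ) (b : Fin n → ℝ) :
    ∃ a : Fin n → ℝ, ∀ m : Fin n, ∑ i, a i * ((i : ℝ) + 1) ^ (m : ℕ) = b m := by
  let M := Matrix.vandermonde (fun i : Fin n => (i : ℝ) + 1)
  have hM : IsUnit M.det := by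
    rw [isUnit_iff_ne_zero]
    refine Matrix.det_vandermonde_ne_zero_iff.2 fun i j h => ?_
    simpa [Fin.ext_iff] using h
  refine ⟨Matrix.vecMul b M⁻¹, fun m => ?_⟩
  have : Matrix.vecMul (Matrix.vecMul b M⁻¹) M = b := by
    rw [Matrix.vecMul_vecMul, Matrix.nonsing_inv_mul _ hM, Matrix.vecMul_one]
  exact congrFun this m

/-- A function can be modified such that its derivative of order `n` at a point vanishes
and its derivatives of lower orders there are kept. -/
theorem exists_iteratedFDeriv_eq_zero {u : E → F} {x : E} (hu : ∀ᶠ z in 𝓝 x, ContDiffAt ℝ ∞ u z)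
    (n : ℕ) : ∃ v : E → F, (∀ᶠ z in 𝓝 x, ContDiffAt ℝ ∞ v z) ∧ iteratedFDeriv ℝ n v x = 0 ∧
      ∀ m < n, iteratedFDeriv ℝ m v x = iteratedFDeriv ℝ m u x := by
  -- Combining dilates of `u` about `x` multiplies its derivative of order `m` by the `m`-th moment
  -- of the weights, which therefore has to be 1 for `m < n` and 0 for `m = n`.
  obtain ⟨a, ha⟩ := exists_moments (n + 1) (fun m => if (m : ℕ) = n then 0 else 1)
  let w : Fin (n + 1) → E → F := fun i z => u (x + ((i : ℝ) + 1) • (z - x))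
  have hw : ∀ i, ∀ᶠ z in 𝓝 x, ContDiffAt ℝ ∞ (w i) z := by
    intro i
    have hc : Tendsto (fun z => x + ((i : ℝ) + 1) • (z - x)) (𝓝 x) (𝓝 x) := by
      have : Continuous (fun z => x + ((i : ℝ) + 1) • (z - x)) := by fun_prop
      simpa using this.tendsto x
    filter_upwards [hc.eventually hu] with z hz
    exact hz.comp z (by fun_prop)
  have hd : ∀ m, iteratedFDeriv ℝ m (fun z => ∑ i, a i • w i z) x =
      (∑ i, a i * ((i : ℝ) + 1) ^ m) • iteratedFDeriv ℝ m u x := by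
    intro m
    have hwm : ∀ i, ContDiffAt ℝ m (w i) x := fun i =>
      (hw i).self_of_nhds.of_le (mod_cast le_top)
    rw [iteratedFDeriv_fun_sum_apply fun i _ => (hwm i).const_smul (a i), Finset.sum_smul]
    refine Finset.sum_congr rfl fun i _ => ?_
    rw [iteratedFDeriv_const_smul_apply' (hwm i), mul_smul]
    congr 1
    exact iteratedFDeriv_comp_homothety (by positivity) u x m
  refine ⟨fun z => ∑ i, a i • w i z, ?_, ?_, fun m hm => ?_⟩
  · filter_upwards [eventually_all.2 hw] with z hz
    exact ContDiffAt.sum fun i _ => (hz i).const_smul (a i)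
  · rw [hd n]
    have := ha (Fin.last n)
    simp only [Fin.val_last, if_true] at this
    rw [this, zero_smul]
  · rw [hd m]
    have := ha ⟨m, by omega⟩
    simp only [hm.ne, if_false] at this
    rw [this, one_smul]

end KillTop

/-! ### Sigma-compactness, needed for partitions of unity -/

section SigmaCompact

/-- Take a locally finite cover by relatively compact open sets. Starting from a point, pass
repeatedly to the union of the closures of all members that meet the present set. Local finiteness
keeps every stage compact; the union of the stages is clopen, hence everything by connectedness. -/
theorem sigmaCompactSpace_of_paracompact_connected (M : Type*) [TopologicalSpace M] [T2Space M]
    [LocallyCompactSpace M] [ParacompactSpace M] [ConnectedSpace M] : SigmaCompactSpace M := by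
  choose K hK hKx using fun x : M => exists_compact_mem_nhds x
  obtain ⟨V, hVo, hVc, hVf, hVK⟩ := precise_refinement (fun x => interior (K x))
    (fun _ => isOpen_interior)
    (eq_univ_of_forall fun x => mem_iUnion.2 ⟨x, mem_interior_iff_mem_nhds.2 (hKx x)⟩)
  have hVcomp : ∀ x, IsCompact (closure (V x)) := fun x =>
    (hK x).of_isClosed_subset isClosed_closure
      (closure_minimal ((hVK x).trans interior_subset) (hK x).isClosed)
  let next : Set M → Set M := fun C => ⋃ x ∈ {x | (V x ∩ C).Nonempty}, closure (V x)
  have hnext : ∀ C, IsCompact C → IsCompact (next C) := fun C hC =>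
    (hVf.finite_nonempty_inter_compact hC).isCompact_biUnion fun x _ => hVcomp x
  let x₀ : M := Classical.arbitrary M
  let L : ℕ → Set M := fun n => next^[n] {x₀}
  have hL : ∀ n, L (n + 1) = next (L n) := fun n => Function.iterate_succ_apply' next n {x₀}
  have hLc : ∀ n, IsCompact (L n) := by
    intro n
    induction n with
    | zero => exact isCompact_singleton
    | succ n ih => rw [hL]; exact hnext _ ih
  have key : ∀ n x, (V x ∩ L n).Nonempty → V x ⊆ ⋃ n, L n := by
    intro n x hx y hy
    refine mem_iUnion.2 ⟨n + 1, ?_⟩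
    rw [hL]
    exact mem_biUnion (show x ∈ {x | (V x ∩ L n).Nonempty} from hx) (subset_closure hy)
  have hcov : ∀ y, ∃ x, y ∈ V x := fun y => mem_iUnion.1 (hVc ▸ mem_univ y)
  have hopen : IsOpen (⋃ n, L n) := by
    refine isOpen_iff_mem_nhds.2 fun y hy => ?_
    obtain ⟨n, hn⟩ := mem_iUnion.1 hy
    obtain ⟨x, hx⟩ := hcov y
    exact mem_of_superset ((hVo x).mem_nhds hx) (key n x ⟨y, hx, hn⟩)
  have hclosed : IsClosed (⋃ n, L n) := by
    refine isClosed_of_closure_subset fun y hy => ?_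
    obtain ⟨x, hx⟩ := hcov y
    obtain ⟨z, hz, hz'⟩ := mem_closure_iff_nhds.1 hy (V x) ((hVo x).mem_nhds hx)
    obtain ⟨n, hn⟩ := mem_iUnion.1 hz'
    exact key n x ⟨z, hz, hn⟩ hx
  refine ⟨⟨L, hLc, IsClopen.eq_univ ⟨hclosed, hopen⟩ ⟨x₀, mem_iUnion.2 ⟨0, rfl⟩⟩⟩⟩

end SigmaCompact

/-! ### Bundle charts and local representatives -/

section

variable {EX EY EF : Type*}
  [NormedAddCommGroup EX] [NormedSpace ℝ EX] [NormedAddCommGroup EY] [NormedSpace ℝ EY]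
  [NormedAddCommGroup EF] [NormedSpace ℝ EF]
  {X Y : Type*} [TopologicalSpace X] [ChartedSpace EX X]
  [TopologicalSpace Y] [ChartedSpace EY Y] {π : Y → X}

/-- A local trivialization followed by a product of charts of `X` and `F`. -/
theorem IsSmoothFibreBundle.exists_bundleChart [IsManifold 𝓘(ℝ, EX) ∞ X] {F : Type*}
    [TopologicalSpace F] [ChartedSpace EF F] [IsManifold 𝓘(ℝ, EF) ∞ F]
    (hπ : IsSmoothFibreBundle EX EY EF F π) (y : Y) :
    ∃ c : BundleChart EX EY EF π, y ∈ c.total.source := by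
  obtain ⟨e, he, hs, ht⟩ := hπ.locally_trivial (π y)
  let base : OpenPartialHomeomorph X EX := (chartAt EX (π y)).restrOpen e.baseSet e.open_baseSet
  let fib : OpenPartialHomeomorph F EF := chartAt EF (e y).2
  have hbs : base.source ⊆ (chartAt EX (π y)).source := inter_subset_left
  have hbt : base.target ⊆ (chartAt EX (π y)).target := by
    intro z hz
    have h1 := base.map_target hz
    have h2 := (chartAt EX (π y)).map_source (hbs h1)
    have h3 : chartAt EX (π y) (base.symm z) = z := base.right_inv hz
    rwa [h3] at h2
  have sb : ContMDiffOn 𝓘(ℝ, EX) 𝓘(ℝ, EX) ∞ base base.source := contMDiffOn_chart.mono hbs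
  have sb' : ContMDiffOn 𝓘(ℝ, EX) 𝓘(ℝ, EX) ∞ base.symm base.target :=
    contMDiffOn_chart_symm.mono hbt
  have sf : ContMDiffOn 𝓘(ℝ, EF) 𝓘(ℝ, EF) ∞ fib fib.source := contMDiffOn_chart
  have sf' : ContMDiffOn 𝓘(ℝ, EF) 𝓘(ℝ, EF) ∞ fib.symm fib.target := contMDiffOn_chart_symm
  let total : OpenPartialHomeomorph Y (EX × EF) := e.toOpenPartialHomeomorph.trans (base.prod fib)
  have hts : ∀ {y'}, y' ∈ total.source ↔
      y' ∈ e.source ∧ (e y').1 ∈ base.source ∧ (e y').2 ∈ fib.source := by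
    intro y'
    simp [total, mem_prod]
  have htt : ∀ {q}, q ∈ total.target ↔ (q.1 ∈ base.target ∧ q.2 ∈ fib.target) ∧
      (base.symm q.1, fib.symm q.2) ∈ e.target := by
    intro q
    simp [total, mem_prod]
  have hye : y ∈ e.source := e.mem_source.2 he
  refine ⟨⟨base, total, sb, sb', ?_, ?_, ?_, ?_⟩, ?_⟩
  · have h1 : ContMDiffOn 𝓘(ℝ, EY) 𝓘(ℝ, EX) ∞ (fun y' => base (e y').1) total.source :=
      sb.comp (contMDiff_fst.comp_contMDiffOn (hs.mono fun y' h => (hts.1 h).1))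
        fun y' h => (hts.1 h).2.1
    have h2 : ContMDiffOn 𝓘(ℝ, EY) 𝓘(ℝ, EF) ∞ (fun y' => fib (e y').2) total.source :=
      sf.comp (contMDiff_snd.comp_contMDiffOn (hs.mono fun y' h => (hts.1 h).1))
        fun y' h => (hts.1 h).2.2
    exact h1.prodMk_space h2
  · have h1 : ContMDiffOn 𝓘(ℝ, EX × EF) 𝓘(ℝ, EX) ∞ (fun q : EX × EF => base.symm q.1)
        total.target :=
      sb'.comp contDiff_fst.contMDiff.contMDiffOn fun q h => (htt.1 h).1.1
    have h2 : ContMDiffOn 𝓘(ℝ, EX × EF) 𝓘(ℝ, EF) ∞ (fun q : EX × EF => fib.symm q.2)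
        total.target :=
      sf'.comp contDiff_snd.contMDiff.contMDiffOn fun q h => (htt.1 h).1.2
    exact ht.comp (h1.prodMk h2) fun q h => (htt.1 h).2
  · intro y' h
    have := (hts.1 h).2.1
    rwa [e.coe_fst (hts.1 h).1] at this
  · intro y' h
    change base (e y').1 = base (π y')
    rw [e.coe_fst (hts.1 h).1]
  · refine hts.2 ⟨hye, ?_, mem_chart_source _ _⟩
    rw [e.coe_fst hye]
    exact ⟨mem_chart_source _ _, he⟩

namespace BundleChart

variable (c c' : BundleChart EX EY EF π)

theorem symm_fst {q : EX × EF} (hq : q ∈ c.total.target) :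
    q.1 ∈ c.base.target ∧ π (c.total.symm q) = c.base.symm q.1 := by
  have h1 := c.total.map_target hq
  have h2 := c.proj_mem _ h1
  have h3 := c.fst_eq _ h1
  rw [c.total.right_inv hq] at h3
  rw [h3]
  exact ⟨c.base.map_source h2, (c.base.left_inv h2).symm⟩

/-- The change of base coordinates from the chart `c'` to the chart `c`. -/
def baseChange : EX → EX := fun z => c.base (c'.base.symm z)

/-- The fibre coordinates of the chart `c'` as functions of the coordinates of the chart `c`. -/
def fibreChange : EX × EF → EF := fun q => (c'.total (c.total.symm q)).2

/-- The overlap of the domains of two charts, in the coordinates of the first one. -/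
def overlap : Set (EX × EF) := c.total.target ∩ c.total.symm ⁻¹' c'.total.source

theorem contDiffAt_baseChange {z : EX} (hz : z ∈ c'.base.target)
    (hz' : c'.base.symm z ∈ c.base.source) : ContDiffAt ℝ ∞ (c.baseChange c') z := by
  rw [← contMDiffAt_iff_contDiffAt]
  exact (c.base_smooth.contMDiffAt (c.base.open_source.mem_nhds hz')).comp z
    (c'.base_symm_smooth.contMDiffAt (c'.base.open_target.mem_nhds hz))

theorem contDiffAt_fibreChange {q : EX × EF} (hq : q ∈ c.overlap c') :
    ContDiffAt ℝ ∞ (c.fibreChange c') q := by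
  have h : ContDiffAt ℝ ∞ (fun q => c'.total (c.total.symm q)) q := by
    rw [← contMDiffAt_iff_contDiffAt]
    exact (c'.total_smooth.contMDiffAt (c'.total.open_source.mem_nhds hq.2)).comp q
      (c.total_symm_smooth.contMDiffAt (c.total.open_target.mem_nhds hq.1))
  exact h.snd

end BundleChart

namespace LocalSection

variable (s : LocalSection EX EY π) (c c' : BundleChart EX EY EF π)

theorem proj_val : π s.val = s.pt := s.isSection.self_of_nhds

variable {s c c'}

theorem pt_mem (hs : s.val ∈ c.total.source) : s.pt ∈ c.base.source :=
  s.proj_val ▸ c.proj_mem _ hs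

theorem eventually_nhds_pt (hs : s.val ∈ c.total.source) :
    ∀ᶠ x in 𝓝 s.pt, x ∈ c.base.source ∧ s.toFun x ∈ c.total.source ∧ π (s.toFun x) = x ∧
      ContMDiffAt 𝓘(ℝ, EX) 𝓘(ℝ, EY) ∞ s.toFun x := by
  have h := s.smooth.self_of_nhds.continuousAt.eventually (c.total.open_source.mem_nhds hs)
  filter_upwards [c.base.open_source.mem_nhds (pt_mem hs), h, s.isSection, s.smooth]
    with x h1 h2 h3 h4 using ⟨h1, h2, h3, h4⟩

theorem tendsto_base_symm (hs : s.val ∈ c.total.source) :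
    Tendsto c.base.symm (𝓝 (c.base s.pt)) (𝓝 s.pt) := by
  have := c.base.continuousAt_symm (c.base.map_source (pt_mem hs))
  rwa [ContinuousAt, c.base.left_inv (pt_mem hs)] at this

theorem total_apply (hs : s.val ∈ c.total.source) :
    c.total s.val = (c.base s.pt, s.rep c (c.base s.pt)) := by
  refine Prod.ext ?_ ?_
  · rw [c.fst_eq _ hs, s.proj_val]
  · simp only [rep, c.base.left_inv (pt_mem hs)]; rfl

theorem eventually_contDiffAt_rep (hs : s.val ∈ c.total.source) :
    ∀ᶠ z in 𝓝 (c.base s.pt), ContDiffAt ℝ ∞ (s.rep c) z := by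
  filter_upwards [(tendsto_base_symm hs).eventually (eventually_nhds_pt hs),
    c.base.open_target.mem_nhds (c.base.map_source (pt_mem hs))] with z ⟨_, h2, _, h4⟩ hz
  have h : ContDiffAt ℝ ∞ (fun z => c.total (s.toFun (c.base.symm z))) z := by
    rw [← contMDiffAt_iff_contDiffAt]
    exact (c.total_smooth.contMDiffAt (c.total.open_source.mem_nhds h2)).comp z
      (h4.comp z (c.base_symm_smooth.contMDiffAt (c.base.open_target.mem_nhds hz)))
  exact h.snd

/-- With base change ψ and fibre change φ, the representatives satisfy u' = φ ∘ (id, u) ∘ ψ near the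
point; differentiating this gives the transition law of jet coordinates. -/
theorem rep_eventuallyEq (hs : s.val ∈ c.total.source) (hs' : s.val ∈ c'.total.source) :
    s.rep c' =ᶠ[𝓝 (c'.base s.pt)]
      (c.fibreChange c' ∘ fun z => (z, s.rep c z)) ∘ c.baseChange c' := by
  filter_upwards [(tendsto_base_symm hs').eventually (eventually_nhds_pt hs)]
    with z ⟨h1, h2, h3, _⟩
  simp only [Function.comp, BundleChart.fibreChange, BundleChart.baseChange, rep,
    c.base.left_inv h1]
  have : (c.base (c'.base.symm z), (c.total (s.toFun (c'.base.symm z))).2) =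
      c.total (s.toFun (c'.base.symm z)) := Prod.ext (by rw [c.fst_eq _ h2, h3]) rfl
  rw [this, c.total.left_inv h2]

theorem jetCoord_eq (hs : s.val ∈ c.total.source) (k : ℕ) : s.jetCoord c k =
    (c.base s.pt, fun m : Fin (k + 1) => iteratedFDeriv ℝ (m : ℕ) (s.rep c) (c.base s.pt)) :=
  if_pos hs

end LocalSection

/-! ### Transition maps of jet coordinates -/

section Transition

/-- The point of `EX × EF` that underlies a point of the coordinate space of jets. -/
def jetPoint {k : ℕ} (p : JetCoord EX EF k) : EX × EF := (p.1, p.2 0 fun _ => 0)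

/-- The coordinates of a `k`-jet as a truncated Taylor series. -/
def jetSeries {k : ℕ} (p : JetCoord EX EF k) : FormalMultilinearSeries ℝ EX EF :=
  fun m => if h : m < k + 1 then p.2 ⟨m, h⟩ else 0

theorem jetSeries_of_lt {k m : ℕ} (p : JetCoord EX EF k) (h : m < k + 1) :
    jetSeries p m = p.2 ⟨m, h⟩ := dif_pos h

/-- The Taylor series at `x` of `z ↦ (z, u z)`, where `w` is that of `u`. -/
def graphSeries (x : EX) (w : FormalMultilinearSeries ℝ EX EF) :
    FormalMultilinearSeries ℝ EX (EX × EF) :=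
  fun m => (iteratedFDeriv ℝ m (fun z : EX => z) x).prod (w m)

namespace BundleChart

variable (c c' : BundleChart EX EY EF π)

/-- The Taylor series in the base coordinates of `c` of the fibre coordinates of `c'`. -/
def fibreSeries {k : ℕ} (p : JetCoord EX EF k) : FormalMultilinearSeries ℝ EX EF :=
  (ftaylorSeries ℝ (c.fibreChange c') (jetPoint p)).taylorComp (graphSeries p.1 (jetSeries p))

/-- The transition map of jet coordinates between two bundle charts. -/
def transition {k : ℕ} (p : JetCoord EX EF k) : JetCoord EX EF k :=
  (c'.base (c.base.symm p.1), fun m => (c.fibreSeries c' p).taylorComp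
    (ftaylorSeries ℝ (c.baseChange c') (c'.base (c.base.symm p.1))) m)

variable {c c'}

theorem jetPoint_jetCoord {s : LocalSection EX EY π} (hs : s.val ∈ c.total.source) (k : ℕ) :
    jetPoint (s.jetCoord c k) = c.total s.val := by
  rw [LocalSection.total_apply hs, LocalSection.jetCoord_eq hs]
  rfl

theorem mem_overlap {y : Y} (hy : y ∈ c.total.source) (hy' : y ∈ c'.total.source) :
    c.total y ∈ c.overlap c' := by
  refine ⟨c.total.map_source hy, ?_⟩
  rwa [mem_preimage, c.total.left_inv hy]

/-- The Faà di Bruno formula is applied twice to `LocalSection.rep_eventuallyEq`. Derivatives of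
order `m` of the new representative involve only orders up to `m` of the old one, so the truncated
series suffices. -/
theorem jetCoord_eq_transition {s : LocalSection EX EY π} (hs : s.val ∈ c.total.source)
    (hs' : s.val ∈ c'.total.source) (k : ℕ) :
    s.jetCoord c' k = c.transition c' (s.jetCoord c k) := by
  have hpt := LocalSection.pt_mem hs
  have hpt' := LocalSection.pt_mem hs'
  have hP := jetPoint_jetCoord hs k
  unfold transition fibreSeries
  rw [hP, LocalSection.total_apply hs]
  rw [LocalSection.jetCoord_eq hs, LocalSection.jetCoord_eq hs']
  simp only [c.base.left_inv hpt]
  refine Prod.ext rfl (funext fun m => ?_)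
  have hψ : c.baseChange c' (c'.base s.pt) = c.base s.pt := by
    simp only [baseChange, c'.base.left_inv hpt']
  have hψs : ContDiffAt ℝ m (c.baseChange c') (c'.base s.pt) :=
    (contDiffAt_baseChange c c' (c'.base.map_source hpt')
      (by rwa [c'.base.left_inv hpt'])).of_le (mod_cast le_top)
  have hu : ∀ n : ℕ, ContDiffAt ℝ n (s.rep c) (c.base s.pt) := fun n =>
    (LocalSection.eventually_contDiffAt_rep hs).self_of_nhds.of_le (mod_cast le_top)
  have hφ : ∀ n : ℕ, ContDiffAt ℝ n (c.fibreChange c') (c.base s.pt, s.rep c (c.base s.pt)) :=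
    fun n => (contDiffAt_fibreChange c c'
      (LocalSection.total_apply hs ▸ mem_overlap hs hs')).of_le (mod_cast le_top)
  have hg : ∀ n : ℕ, ContDiffAt ℝ n (fun z => (z, s.rep c z)) (c.base s.pt) := fun n =>
    contDiffAt_id.prodMk (hu n)
  change iteratedFDeriv ℝ (m : ℕ) (s.rep c') (c'.base s.pt) = _
  rw [((LocalSection.rep_eventuallyEq hs hs').iteratedFDeriv ℝ m).eq_of_nhds,
    iteratedFDeriv_comp (n := m) (by rw [hψ]; exact ContDiffAt.comp (f := fun z => (z, s.rep c z)) _ (hφ m) (hg m)) hψs le_rfl, hψ]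
  refine taylorComp_congr (fun i hi => ?_) fun _ _ => rfl
  change iteratedFDeriv ℝ i _ _ = _
  rw [iteratedFDeriv_comp (f := fun z => (z, s.rep c z)) (n := i) (hφ i) (hg i) le_rfl]
  refine taylorComp_congr (fun _ _ => rfl) fun j hj => ?_
  change iteratedFDeriv ℝ j _ _ = _
  refine (iteratedFDeriv_prodMk (f := fun z => z) (n := j) contDiffAt_id (hu j) le_rfl).trans ?_
  unfold graphSeries
  rw [jetSeries_of_lt _ (by omega)]

theorem contDiff_jetPoint (k : ℕ) : ContDiff ℝ ∞ (jetPoint : JetCoord EX EF k → EX × EF) := by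
  refine contDiff_fst.prodMk ?_
  have h : ContDiff ℝ ∞ (fun p : JetCoord EX EF k => p.2 0) :=
    contDiff_pi.1 contDiff_snd 0
  exact (ContinuousMultilinearMap.apply ℝ _ EF (fun _ => (0 : EX))).contDiff.comp h

theorem contDiff_jetSeries (k m : ℕ) :
    ContDiff ℝ ∞ (fun p : JetCoord EX EF k => jetSeries p m) := by
  by_cases h : m < k + 1
  · simp only [jetSeries_of_lt _ h]
    exact contDiff_pi.1 contDiff_snd _
  · simp only [jetSeries, dif_neg h]
    exact contDiff_const

/-- The coefficients are derivatives of the smooth chart changes at points depending smoothly on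
`p`; they enter together with the jet coordinates through `ContDiffAt.taylorComp`. -/
theorem contDiffAt_transition {k : ℕ} {p : JetCoord EX EF k} (hp : jetPoint p ∈ c.overlap c') :
    ContDiffAt ℝ ∞ (c.transition c' : JetCoord EX EF k → JetCoord EX EF k) p := by
  have h1 : p.1 ∈ c.base.target := (c.symm_fst hp.1).1
  have h2 : c.base.symm p.1 ∈ c'.base.source := by
    have := c'.proj_mem _ hp.2
    rwa [(c.symm_fst hp.1).2] at this
  have hb : ContDiffAt ℝ ∞ (fun p : JetCoord EX EF k => c'.base (c.base.symm p.1)) p :=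
    (contDiffAt_baseChange c' c h1 h2).comp p contDiffAt_fst
  refine hb.prodMk (contDiffAt_pi.2 fun m => ?_)
  refine ContDiffAt.taylorComp (fun i _ => ?_) fun i _ => ?_
  · refine ContDiffAt.taylorComp (fun j _ => ?_) fun j _ => ?_
    · exact ((contDiffAt_fibreChange c c' hp).iteratedFDeriv_right (m := ∞) (i := j)
        (mod_cast le_top)).comp p (contDiff_jetPoint k).contDiffAt
    · have hid : ContDiffAt ℝ ∞ (iteratedFDeriv ℝ j (fun z : EX => z)) p.1 :=
        contDiffAt_id.iteratedFDeriv_right (m := ∞) (n := ∞) (mod_cast le_top)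
      have h3 := (hid.comp p contDiffAt_fst).prodMk (contDiff_jetSeries k j).contDiffAt
      exact (ContinuousMultilinearMap.prodL ℝ (fun _ : Fin j => EX) EX
        EF).toContinuousLinearEquiv.contDiff.contDiffAt.comp p h3
  · have h3 : ContDiffAt ℝ ∞ (c.baseChange c') (c'.base (c.base.symm p.1)) :=
      contDiffAt_baseChange c c' (c'.base.map_source h2)
        (by rw [c'.base.left_inv h2]; exact c.base.map_target h1)
    exact (h3.iteratedFDeriv_right (m := ∞) (i := i) (mod_cast le_top)).comp p hb

/-- The graph series has affine dependence on the top coordinates. Composing with the fibre change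
preserves this by `taylorComp_sum_right`, and composing with the base change by linearity in the
outer series. -/
theorem transition_sum {ι : Type*} (S : Finset ι) (a : ι → ℝ) (ha : ∑ i ∈ S, a i = 1) {k : ℕ}
    {P : JetCoord EX EF (k + 1)} {p : ι → JetCoord EX EF (k + 1)}
    (hbase : ∀ i ∈ S, (p i).1 = P.1)
    (hlow : ∀ i ∈ S, ∀ m : Fin (k + 1), (p i).2 m.castSucc = P.2 m.castSucc)
    (htop : P.2 (Fin.last (k + 1)) = ∑ i ∈ S, a i • (p i).2 (Fin.last (k + 1))) :
    (c.transition c' P).2 (Fin.last (k + 1)) =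
      ∑ i ∈ S, a i • (c.transition c' (p i)).2 (Fin.last (k + 1)) := by
  have hpt : ∀ i ∈ S, jetPoint (p i) = jetPoint P := fun i hi =>
    Prod.ext (hbase i hi) (congrArg (fun f => f fun _ => 0) (hlow i hi 0))
  have hser : ∀ m < k + 1, ∀ i ∈ S, jetSeries (p i) m = jetSeries P m := by
    intro m hm i hi
    rw [jetSeries_of_lt _ (by omega), jetSeries_of_lt _ (by omega)]
    exact hlow i hi ⟨m, hm⟩
  have hg : ∀ m < k + 1, ∀ i ∈ S,
      graphSeries (p i).1 (jetSeries (p i)) m = graphSeries P.1 (jetSeries P) m := by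
    intro m hm i hi
    unfold graphSeries
    rw [hser m hm i hi, hbase i hi]
  have hgtop : graphSeries P.1 (jetSeries P) (k + 1) =
      ∑ i ∈ S, a i • graphSeries (p i).1 (jetSeries (p i)) (k + 1) := by
    have e : jetSeries P (k + 1) = ∑ i ∈ S, a i • jetSeries (p i) (k + 1) := by
      rw [jetSeries_of_lt _ (by omega)]
      refine htop.trans (Finset.sum_congr rfl fun i _ => ?_)
      rw [jetSeries_of_lt _ (by omega)]
      rfl
    have e' : ∑ i ∈ S, a i • graphSeries (p i).1 (jetSeries (p i)) (k + 1) =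
        ∑ i ∈ S, a i • (iteratedFDeriv ℝ (k + 1) (fun z : EX => z) P.1).prod
          (jetSeries (p i) (k + 1)) :=
      Finset.sum_congr rfl fun i hi => by unfold graphSeries; rw [hbase i hi]
    rw [e']
    ext v
    · simp [graphSeries, Prod.fst_sum, ← Finset.sum_smul, ha]
    · simp [graphSeries, Prod.snd_sum, e]
  have hf : ∀ m ≤ k + 1,
      c.fibreSeries c' P m = ∑ i ∈ S, a i • c.fibreSeries c' (p i) m := by
    intro m hm
    rcases hm.lt_or_eq with hm | rfl
    · have : ∀ i ∈ S, a i • c.fibreSeries c' (p i) m = a i • c.fibreSeries c' P m := by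
        intro i hi
        unfold fibreSeries
        rw [hpt i hi]
        congr 1
        exact taylorComp_congr (fun _ _ => rfl) fun j hj => hg j (by omega) i hi
      rw [Finset.sum_congr rfl this, ← Finset.sum_smul, ha, one_smul]
    · unfold fibreSeries
      rw [Finset.sum_congr rfl fun i hi => by rw [hpt i hi]]
      exact taylorComp_sum_right S a ha _ (by omega) (fun m hm i hi => hg m hm i hi) hgtop
  have h := taylorComp_sum_left S a (ftaylorSeries ℝ (c.baseChange c')
    (c'.base (c.base.symm P.1))) hf
  refine h.trans (Finset.sum_congr rfl fun i hi => ?_)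
  unfold transition
  rw [hbase i hi]
  rfl

end BundleChart

end Transition

/-- The local section with a given representative in a bundle chart. -/
def BundleChart.sectionOfRep (c : BundleChart EX EY EF π) (x : EX) (u : EX → EF)
    (hu : ∀ᶠ z in 𝓝 x, ContDiffAt ℝ ∞ u z) (hx : (x, u x) ∈ c.total.target) :
    LocalSection EX EY π where
  pt := c.base.symm x
  toFun b := c.total.symm (c.base b, u (c.base b))
  smooth := by
    have hxb := (c.symm_fst hx).1
    have hb := c.base.map_target hxb
    have hc : Tendsto c.base (𝓝 (c.base.symm x)) (𝓝 x) := by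
      have := c.base.continuousAt hb
      rwa [ContinuousAt, c.base.right_inv hxb] at this
    have h2 : ∀ᶠ z in 𝓝 x, (z, u z) ∈ c.total.target :=
      (continuousAt_id.prodMk hu.self_of_nhds.continuousAt).eventually
        (c.total.open_target.mem_nhds hx)
    filter_upwards [hc.eventually (hu.and h2), c.base.open_source.mem_nhds hb]
      with b ⟨h3, h4⟩ h5
    have h6 := c.base_smooth.contMDiffAt (c.base.open_source.mem_nhds h5)
    exact (c.total_symm_smooth.contMDiffAt (c.total.open_target.mem_nhds h4)).comp b
      (h6.prodMk_space (h3.contMDiffAt.comp b h6))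
  isSection := by
    have hxb := (c.symm_fst hx).1
    have hb := c.base.map_target hxb
    have hc : Tendsto c.base (𝓝 (c.base.symm x)) (𝓝 x) := by
      have := c.base.continuousAt hb
      rwa [ContinuousAt, c.base.right_inv hxb] at this
    have h2 : ∀ᶠ z in 𝓝 x, (z, u z) ∈ c.total.target :=
      (continuousAt_id.prodMk hu.self_of_nhds.continuousAt).eventually
        (c.total.open_target.mem_nhds hx)
    filter_upwards [hc.eventually h2, c.base.open_source.mem_nhds hb] with b h4 h5
    rw [(c.symm_fst h4).2, c.base.left_inv h5]

section SectionOfRep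

variable {c : BundleChart EX EY EF π} {x : EX} {u : EX → EF}
  (hu : ∀ᶠ z in 𝓝 x, ContDiffAt ℝ ∞ u z) (hx : (x, u x) ∈ c.total.target)

theorem BundleChart.sectionOfRep_val :
    (c.sectionOfRep x u hu hx).val = c.total.symm (x, u x) := by
  change c.total.symm (c.base (c.base.symm x), u (c.base (c.base.symm x))) = _
  rw [c.base.right_inv (c.symm_fst hx).1]

theorem BundleChart.sectionOfRep_val_mem :
    (c.sectionOfRep x u hu hx).val ∈ c.total.source := by
  rw [sectionOfRep_val]
  exact c.total.map_target hx

theorem BundleChart.sectionOfRep_jetCoord (k : ℕ) : (c.sectionOfRep x u hu hx).jetCoord c k =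
    (x, fun m : Fin (k + 1) => iteratedFDeriv ℝ (m : ℕ) u x) := by
  have hxb := (c.symm_fst hx).1
  have hpt : c.base (c.sectionOfRep x u hu hx).pt = x := c.base.right_inv hxb
  rw [LocalSection.jetCoord_eq (sectionOfRep_val_mem hu hx), hpt]
  refine Prod.ext rfl (funext fun m => ?_)
  have h2 : ∀ᶠ z in 𝓝 x, (z, u z) ∈ c.total.target :=
    (continuousAt_id.prodMk hu.self_of_nhds.continuousAt).eventually
      (c.total.open_target.mem_nhds hx)
  refine (Filter.EventuallyEq.iteratedFDeriv ℝ ?_ m).eq_of_nhds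
  filter_upwards [h2, c.base.open_target.mem_nhds hxb] with z h3 h4
  change (c.total (c.total.symm (c.base (c.base.symm z), u (c.base (c.base.symm z))))).2 = u z
  rw [c.base.right_inv h4, c.total.right_inv h3]

end SectionOfRep

end

/-! ### Jets through their coordinates; affine structure of the fibres -/

section

variable {EX EY EF : Type*}
  [NormedAddCommGroup EX] [NormedSpace ℝ EX] [NormedAddCommGroup EY] [NormedSpace ℝ EY]
  [NormedAddCommGroup EF] [NormedSpace ℝ EF]
  {X Y : Type*} [TopologicalSpace X] [ChartedSpace EX X]
  [TopologicalSpace Y] [ChartedSpace EY Y] {π : Y → X}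

/-- The point of the coordinate space of `(k+1)`-jets with given lower coordinates `p` and
given coordinates `t` of top order. -/
def jetExtend {k : ℕ} (p : JetCoord EX EF k)
    (t : ContinuousMultilinearMap ℝ (fun _ : Fin (k + 1) => EX) EF) : JetCoord EX EF (k + 1) :=
  (p.1, Fin.snoc (α := fun m : Fin (k + 1 + 1) =>
    ContinuousMultilinearMap ℝ (fun _ : Fin (m : ℕ) => EX) EF) p.2 t)

theorem jetExtend_castSucc {k : ℕ} (p : JetCoord EX EF k)
    (t : ContinuousMultilinearMap ℝ (fun _ : Fin (k + 1) => EX) EF) (m : Fin (k + 1)) :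
    (jetExtend p t).2 m.castSucc = p.2 m :=
  Fin.snoc_castSucc (α := fun m : Fin (k + 1 + 1) =>
    ContinuousMultilinearMap ℝ (fun _ : Fin (m : ℕ) => EX) EF) t p.2 m

theorem jetExtend_last {k : ℕ} (p : JetCoord EX EF k)
    (t : ContinuousMultilinearMap ℝ (fun _ : Fin (k + 1) => EX) EF) :
    (jetExtend p t).2 (Fin.last (k + 1)) = t :=
  Fin.snoc_last (α := fun m : Fin (k + 1 + 1) =>
    ContinuousMultilinearMap ℝ (fun _ : Fin (m : ℕ) => EX) EF) t p.2

theorem jetPoint_jetExtend {k : ℕ} (p : JetCoord EX EF k)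
    (t : ContinuousMultilinearMap ℝ (fun _ : Fin (k + 1) => EX) EF) :
    jetPoint (jetExtend p t) = jetPoint p :=
  Prod.ext rfl (congrArg (fun f => f fun _ => 0) (jetExtend_castSucc p t 0))

theorem contDiff_jetExtend (k : ℕ) : ContDiff ℝ ∞ (fun q : JetCoord EX EF k ×
    ContinuousMultilinearMap ℝ (fun _ : Fin (k + 1) => EX) EF => jetExtend q.1 q.2) := by
  refine (contDiff_fst.comp contDiff_fst).prodMk (contDiff_pi.2 fun m => ?_)
  refine Fin.lastCases ?_ (fun m => ?_) m
  · have : (fun q : JetCoord EX EF k × ContinuousMultilinearMap ℝ (fun _ : Fin (k + 1) => EX) EF =>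
        (jetExtend q.1 q.2).2 (Fin.last (k + 1))) = fun q => q.2 :=
      funext fun q => jetExtend_last q.1 q.2
    exact this ▸ contDiff_snd
  · have : (fun q : JetCoord EX EF k × ContinuousMultilinearMap ℝ (fun _ : Fin (k + 1) => EX) EF =>
        (jetExtend q.1 q.2).2 m.castSucc) = fun q => q.1.2 m :=
      funext fun q => jetExtend_castSucc q.1 q.2 m
    exact this ▸ contDiff_pi.1 (contDiff_snd.comp contDiff_fst) m

namespace Jet

variable {c c' : BundleChart EX EY EF π} {k : ℕ}

theorem proj_eval (j : Jet EX EY EF π (k + 1)) : j.proj.eval = j.eval := by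
  induction j using Quotient.inductionOn with | _ s => rfl

theorem coord_eq_jetExtend (c : BundleChart EX EY EF π) (j : Jet EX EY EF π (k + 1)) :
    j.coord c = jetExtend (j.proj.coord c) (j.topCoord c) := by
  induction j using Quotient.inductionOn with | _ s => ?_
  have h : s.jetCoord c (k + 1) = jetExtend (s.jetCoord c k)
      ((s.jetCoord c (k + 1)).2 (Fin.last (k + 1))) := by
    refine Prod.ext ?_ (funext fun m => ?_)
    · change _ = (s.jetCoord c k).1
      unfold LocalSection.jetCoord
      split_ifs <;> rfl
    · refine Fin.lastCases ?_ (fun m => ?_) m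
      · rw [jetExtend_last]
      · rw [jetExtend_castSucc]
        unfold LocalSection.jetCoord
        split_ifs <;> rfl
  exact h

theorem coord_castSucc (c : BundleChart EX EY EF π) (j : Jet EX EY EF π (k + 1))
    (m : Fin (k + 1)) : (j.coord c).2 m.castSucc = (j.proj.coord c).2 m := by
  rw [coord_eq_jetExtend, jetExtend_castSucc]

theorem coord_proj_fst (c : BundleChart EX EY EF π) (j : Jet EX EY EF π (k + 1)) :
    (j.coord c).1 = (j.proj.coord c).1 := by
  rw [coord_eq_jetExtend]
  rfl

theorem jetPoint_coord {j : Jet EX EY EF π k} (hj : j.eval ∈ c.total.source) :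
    jetPoint (j.coord c) = c.total j.eval := by
  induction j using Quotient.inductionOn with | _ s => exact BundleChart.jetPoint_jetCoord hj k

theorem coord_eq_transition {j : Jet EX EY EF π k} (hj : j.eval ∈ c.total.source)
    (hj' : j.eval ∈ c'.total.source) : j.coord c' = c.transition c' (j.coord c) := by
  induction j using Quotient.inductionOn with
  | _ s => exact BundleChart.jetCoord_eq_transition hj hj' k

/-- A jet is determined by its coordinates in one bundle chart. -/
theorem ext_coord {j j' : Jet EX EY EF π k} (hj : j.eval ∈ c.total.source)
    (he : j.eval = j'.eval) (h : j.coord c = j'.coord c) : j = j' := by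
  induction j using Quotient.inductionOn with | _ s => ?_
  induction j' using Quotient.inductionOn with | _ s' => ?_
  have hv : s.val = s'.val := he
  have hs : s.val ∈ c.total.source := hj
  have hc : s.jetCoord c k = s'.jetCoord c k := h
  refine Quotient.sound ⟨?_, hv, fun d => ?_⟩
  · rw [← s.proj_val, ← s'.proj_val, hv]
  · by_cases hd : s.val ∈ d.total.source
    · rw [BundleChart.jetCoord_eq_transition hs hd, hc,
        ← BundleChart.jetCoord_eq_transition (hv ▸ hs) (hv ▸ hd)]
    · unfold LocalSection.jetCoord
      rw [if_neg hd, if_neg (hv ▸ hd)]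

theorem ext_topCoord {j j' : Jet EX EY EF π (k + 1)} (hj : j.eval ∈ c.total.source)
    (hp : j.proj = j'.proj) (h : j.topCoord c = j'.topCoord c) : j = j' :=
  ext_coord hj (by rw [← proj_eval, hp, proj_eval])
    (by rw [coord_eq_jetExtend, coord_eq_jetExtend, hp, h])

theorem ext_eval {j j' : Jet EX EY EF π 0} (hj : j.eval ∈ c.total.source)
    (he : j.eval = j'.eval) : j = j' := by
  refine ext_coord hj he ?_
  have h : jetPoint (j.coord c) = jetPoint (j'.coord c) := by
    rw [jetPoint_coord hj, jetPoint_coord (he ▸ hj), he]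
  refine Prod.ext (Prod.mk.inj h).1 (funext fun m => ?_)
  have h2 := (Prod.mk.inj h).2
  have hm : m = 0 := Fin.ext (by omega)
  subst hm
  ext v
  have hv : v = fun _ => 0 := funext fun i => i.elim0
  rw [hv]
  exact h2

theorem exists_rep {j : Jet EX EY EF π k} (hj : j.eval ∈ c.total.source) :
    ∃ u : EX → EF, (∀ᶠ z in 𝓝 (j.coord c).1, ContDiffAt ℝ ∞ u z) ∧
      ∀ m : Fin (k + 1), (j.coord c).2 m = iteratedFDeriv ℝ (m : ℕ) u (j.coord c).1 := by
  induction j using Quotient.inductionOn with | _ s => ?_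
  have h : s.jetCoord c k = _ := LocalSection.jetCoord_eq hj k
  refine ⟨s.rep c, ?_, fun m => ?_⟩
  · change ∀ᶠ z in 𝓝 (s.jetCoord c k).1, _
    rw [h]
    exact LocalSection.eventually_contDiffAt_rep hj
  · change (s.jetCoord c k).2 m = iteratedFDeriv ℝ (m : ℕ) (s.rep c) (s.jetCoord c k).1
    rw [h]

theorem exists_of_rep {x : EX} {u : EX → EF} (hu : ∀ᶠ z in 𝓝 x, ContDiffAt ℝ ∞ u z)
    (hx : (x, u x) ∈ c.total.target) (k : ℕ) : ∃ j : Jet EX EY EF π k,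
      j.eval = c.total.symm (x, u x) ∧ (j.coord c).1 = x ∧
      ∀ m : Fin (k + 1), (j.coord c).2 m = iteratedFDeriv ℝ (m : ℕ) u x := by
  have h := BundleChart.sectionOfRep_jetCoord hu hx k
  exact ⟨Quotient.mk _ (c.sectionOfRep x u hu hx), BundleChart.sectionOfRep_val hu hx,
    congrArg Prod.fst h, fun m => congrFun (congrArg Prod.snd h) m⟩

/-- A function whose derivatives up to order `k` are the coordinates of the jet `j`
defines a jet of order `k + 1` over `j`. -/
theorem exists_succ_of_rep {j : Jet EX EY EF π k} (hj : j.eval ∈ c.total.source) {u : EX → EF}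
    (hu : ∀ᶠ z in 𝓝 (j.coord c).1, ContDiffAt ℝ ∞ u z)
    (hju : ∀ m : Fin (k + 1), (j.coord c).2 m = iteratedFDeriv ℝ (m : ℕ) u (j.coord c).1) :
    ∃ J : Jet EX EY EF π (k + 1), J.proj = j ∧
      J.topCoord c = iteratedFDeriv ℝ (k + 1) u (j.coord c).1 := by
  have hpt : ((j.coord c).1, u (j.coord c).1) = c.total j.eval := by
    rw [← jetPoint_coord hj]
    refine Prod.ext rfl ?_
    change _ = (j.coord c).2 0 fun _ => 0
    rw [hju 0]
    exact (iteratedFDeriv_zero_apply (𝕜 := ℝ) (f := u) (fun _ => (0 : EX))).symm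
  obtain ⟨J, h1, h2, h3⟩ := exists_of_rep hu (hpt ▸ c.total.map_source hj) (k + 1)
  rw [hpt, c.total.left_inv hj] at h1
  refine ⟨J, ext_coord (c := c) ?_ ?_ (Prod.ext ?_ (funext fun m => ?_)), h3 (Fin.last (k + 1))⟩
  · rwa [proj_eval, h1]
  · rw [proj_eval, h1]
  · rw [← coord_proj_fst, h2]
  · rw [← coord_castSucc, h3, hju]
    rfl

theorem exists_eval_eq {y : Y} (hy : y ∈ c.total.source) : ∃ j : Jet EX EY EF π 0, j.eval = y := by
  obtain ⟨j, h, _⟩ := exists_of_rep (c := c) (x := (c.total y).1) (u := fun _ => (c.total y).2)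
    (Eventually.of_forall fun _ => contDiffAt_const) (c.total.map_source hy) 0
  exact ⟨j, h.trans (c.total.left_inv hy)⟩

/-- Not every multilinear map is the top coordinate of a jet, since derivatives are symmetric; zero
is realized by modifying a representative of `j`. -/
theorem exists_topCoord_eq_zero {j : Jet EX EY EF π k} (hj : j.eval ∈ c.total.source) :
    ∃ J : Jet EX EY EF π (k + 1), J.proj = j ∧ J.topCoord c = 0 := by
  obtain ⟨u, hu, hju⟩ := exists_rep hj
  obtain ⟨v, hv, hv0, hvu⟩ := exists_iteratedFDeriv_eq_zero hu (k + 1)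
  obtain ⟨J, hJ, hJt⟩ := exists_succ_of_rep hj hv fun m => by rw [hju, hvu _ m.2]
  exact ⟨J, hJ, hJt.trans hv0⟩

/-- Affine combinations in the fibres of `J^{k+1} Y → J^k Y`. -/
theorem exists_affineCombination {ι : Type*} (S : Finset ι) (a : ι → ℝ) (ha : ∑ i ∈ S, a i = 1)
    {j : Jet EX EY EF π k} (hj : j.eval ∈ c.total.source) {J : ι → Jet EX EY EF π (k + 1)}
    (hJ : ∀ i ∈ S, (J i).proj = j) :
    ∃ K : Jet EX EY EF π (k + 1), K.proj = j ∧ ∀ d : BundleChart EX EY EF π,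
      j.eval ∈ d.total.source → K.topCoord d = ∑ i ∈ S, a i • (J i).topCoord d := by
  have hJe : ∀ i ∈ S, (J i).eval = j.eval := fun i hi => by rw [← proj_eval, hJ i hi]
  have hex : ∀ i, ∃ u : EX → EF, i ∈ S → (∀ᶠ z in 𝓝 (j.coord c).1, ContDiffAt ℝ ∞ u z) ∧
      ∀ m : Fin (k + 1 + 1), ((J i).coord c).2 m = iteratedFDeriv ℝ (m : ℕ) u (j.coord c).1 := by
    intro i
    by_cases hi : i ∈ S
    · obtain ⟨u, h1, h2⟩ := exists_rep (c := c) (j := J i) (by rwa [hJe i hi])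
      rw [coord_proj_fst, hJ i hi] at h1 h2
      exact ⟨u, fun _ => ⟨h1, h2⟩⟩
    · exact ⟨0, fun h => (hi h).elim⟩
  choose u hu using hex
  have hd : ∀ m : ℕ, iteratedFDeriv ℝ m (fun z => ∑ i ∈ S, a i • u i z) (j.coord c).1 =
      ∑ i ∈ S, a i • iteratedFDeriv ℝ m (u i) (j.coord c).1 := by
    intro m
    have hm : ∀ i ∈ S, ContDiffAt ℝ m (u i) (j.coord c).1 := fun i hi =>
      (hu i hi).1.self_of_nhds.of_le (mod_cast le_top)
    rw [iteratedFDeriv_fun_sum_apply fun i hi => (hm i hi).const_smul (a i)]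
    exact Finset.sum_congr rfl fun i hi => iteratedFDeriv_const_smul_apply' (hm i hi)
  have hsm : ∀ᶠ z in 𝓝 (j.coord c).1, ContDiffAt ℝ ∞ (fun z => ∑ i ∈ S, a i • u i z) z := by
    filter_upwards [(Finset.eventually_all S).2 fun i hi => (hu i hi).1] with z hz
    exact ContDiffAt.sum fun i hi => (hz i hi).const_smul (a i)
  obtain ⟨K, hK, hKt⟩ := exists_succ_of_rep hj hsm fun m => by
    rw [hd]
    have : ∀ i ∈ S, a i • iteratedFDeriv ℝ (m : ℕ) (u i) (j.coord c).1 =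
        a i • (j.coord c).2 m := fun i hi => by
      rw [← hJ i hi, ← coord_castSucc, (hu i hi).2, hJ i hi]
      rfl
    rw [Finset.sum_congr rfl this, ← Finset.sum_smul, ha, one_smul]
  rw [hd] at hKt
  have htop : K.topCoord c = ∑ i ∈ S, a i • (J i).topCoord c :=
    hKt.trans (Finset.sum_congr rfl fun i hi => by rw [topCoord, (hu i hi).2]; rfl)
  have hKe : K.eval = j.eval := by rw [← proj_eval, hK]
  -- The formula holds in `c` by construction; affinity of the transition in top order carries it to
  -- every other chart.
  refine ⟨K, hK, fun d hjd => ?_⟩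
  unfold topCoord
  rw [coord_eq_transition (c := c) (c' := d) (hKe ▸ hj) (hKe ▸ hjd)]
  rw [BundleChart.transition_sum S a ha (p := fun i => (J i).coord c)
    (fun i hi => by rw [coord_proj_fst, coord_proj_fst, hK, hJ i hi])
    (fun i hi m => by rw [coord_castSucc, coord_castSucc, hK, hJ i hi]) htop]
  refine Finset.sum_congr rfl fun i hi => ?_
  rw [coord_eq_transition (c := c) (c' := d) (hJe i hi ▸ hj) (hJe i hi ▸ hjd)]

/-! ### Continuity in jet coordinates -/

section Topology

theorem isOpen_coord_preimage (c : BundleChart EX EY EF π) {W : Set (JetCoord EX EF k)}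
    (hW : IsOpen W) :
    IsOpen {j : Jet EX EY EF π k | j.eval ∈ c.total.source ∧ j.coord c ∈ W} :=
  TopologicalSpace.isOpen_generateFrom_of_mem ⟨c, W, hW, rfl⟩

theorem eventually_eval_mem {j : Jet EX EY EF π k} (hj : j.eval ∈ c.total.source) :
    ∀ᶠ j' : Jet EX EY EF π k in 𝓝 j, j'.eval ∈ c.total.source := by
  filter_upwards [(isOpen_coord_preimage c isOpen_univ).mem_nhds ⟨hj, mem_univ _⟩]
    with j' h using h.1

theorem continuousAt_coord {j : Jet EX EY EF π k} (hj : j.eval ∈ c.total.source) :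
    ContinuousAt (fun j' : Jet EX EY EF π k => j'.coord c) j := by
  intro U hU
  obtain ⟨W, hWU, hW, hjW⟩ := mem_nhds_iff.1 hU
  exact mem_map.2 (mem_of_superset ((isOpen_coord_preimage c hW).mem_nhds ⟨hj, hjW⟩)
    fun j' h => hWU h.2)

theorem continuousAt_eval {j : Jet EX EY EF π k} (hj : j.eval ∈ c.total.source) :
    ContinuousAt (fun j' : Jet EX EY EF π k => j'.eval) j := by
  have h1 : ContinuousAt (fun j' : Jet EX EY EF π k => jetPoint (j'.coord c)) j :=
    ContinuousAt.comp (g := jetPoint)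
      (BundleChart.contDiff_jetPoint k).continuous.continuousAt (continuousAt_coord hj)
  have h2 : ContinuousAt (fun j' : Jet EX EY EF π k => c.total.symm (jetPoint (j'.coord c))) j := by
    refine ContinuousAt.comp (g := c.total.symm) ?_ h1
    rw [jetPoint_coord hj]
    exact c.total.continuousAt_symm (c.total.map_source hj)
  refine h2.congr ?_
  filter_upwards [eventually_eval_mem hj] with j' hj'
  rw [jetPoint_coord hj', c.total.left_inv hj']

/-- Continuity of a map to a jet space can be tested in one bundle chart. -/
theorem continuousAt_of_coord {Z : Type*} [TopologicalSpace Z] {g : Z → Jet EX EY EF π k} {z : Z}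
    (hz : (g z).eval ∈ c.total.source) (he : ContinuousAt (fun w => (g w).eval) z)
    (hc : ContinuousAt (fun w => (g w).coord c) z) : ContinuousAt g z := by
  refine TopologicalSpace.tendsto_nhds_generateFrom_iff.2 ?_
  rintro _ ⟨d, W, hW, rfl⟩ ⟨hd, hdW⟩
  have hT : ContinuousAt (c.transition d : JetCoord EX EF k → JetCoord EX EF k) ((g z).coord c) :=
    (BundleChart.contDiffAt_transition (by
      rw [jetPoint_coord hz]; exact BundleChart.mem_overlap hz hd)).continuousAt
  have hd' : ContinuousAt (fun w => c.transition d ((g w).coord c)) z :=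
    ContinuousAt.comp (g := c.transition d) hT hc
  rw [coord_eq_transition hz hd] at hdW
  filter_upwards [he.eventually (c.total.open_source.mem_nhds hz),
    he.eventually (d.total.open_source.mem_nhds hd), hd'.eventually (hW.mem_nhds hdW)]
    with w h1 h2 h3
  refine ⟨h2, ?_⟩
  rwa [coord_eq_transition h1 h2]

end Topology

end Jet

end

/-! ### Smooth global sections -/

section

variable {EX EY EF : Type*}
  [NormedAddCommGroup EX] [NormedSpace ℝ EX] [NormedAddCommGroup EY] [NormedSpace ℝ EY]
  [NormedAddCommGroup EF] [NormedSpace ℝ EF]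
  {X Y : Type*} [TopologicalSpace X] [ChartedSpace EX X]
  [TopologicalSpace Y] [ChartedSpace EY Y] {π : Y → X}

/-- In order zero, composing Taylor series just composes values. -/
theorem BundleChart.jetPoint_transition {c c' : BundleChart EX EY EF π} {k : ℕ}
    {p : JetCoord EX EF k} (hp : jetPoint p ∈ c.overlap c') :
    jetPoint (c.transition c' p) = c'.total (c.total.symm (jetPoint p)) := by
  refine Prod.ext ?_ ?_
  · rw [c'.fst_eq _ hp.2, (c.symm_fst hp.1).2]
    rfl
  · refine (taylorComp_zero_apply (c.fibreSeries c' p) _ _ fun _ => 0).trans ?_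
    refine (taylorComp_zero_apply (ftaylorSeries ℝ (c.fibreChange c') (jetPoint p)) _ _
      fun _ => 0).trans ?_
    exact iteratedFDeriv_zero_apply (𝕜 := ℝ) (f := c.fibreChange c') _

namespace Jet

variable {k : ℕ}

/-- The coordinate expression in the chart `c` of the section of `J^{k+1} Y → J^k Y` whose
coordinates of top order in the chart `d` vanish. -/
def zeroTopCoord (d c : BundleChart EX EY EF π) (p : JetCoord EX EF k) :
    ContinuousMultilinearMap ℝ (fun _ : Fin (k + 1) => EX) EF :=
  (d.transition c (jetExtend (c.transition d p) 0)).2 (Fin.last (k + 1))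

theorem topCoord_eq_zeroTopCoord {d c : BundleChart EX EY EF π} {J : Jet EX EY EF π (k + 1)}
    (hd : J.eval ∈ d.total.source) (hc : J.eval ∈ c.total.source) (h0 : J.topCoord d = 0) :
    J.topCoord c = zeroTopCoord d c (J.proj.coord c) := by
  rw [← proj_eval] at hd hc
  unfold zeroTopCoord
  rw [← coord_eq_transition hc hd, ← h0, ← coord_eq_jetExtend]
  rw [proj_eval] at hd hc
  rw [← coord_eq_transition hd hc]
  rfl

theorem contDiffAt_zeroTopCoord {d c : BundleChart EX EY EF π} {p : JetCoord EX EF k}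
    (hp : jetPoint p ∈ c.overlap d) : ContDiffAt ℝ ∞ (zeroTopCoord d c) p := by
  have h1 := BundleChart.contDiffAt_transition hp
  have h2 : ContDiffAt ℝ ∞ (fun p : JetCoord EX EF k => jetExtend (c.transition d p) 0) p :=
    (contDiff_jetExtend k).contDiffAt.comp p (h1.prodMk contDiffAt_const)
  have h3 : jetPoint (jetExtend (c.transition d p) 0) ∈ d.overlap c := by
    rw [jetPoint_jetExtend, BundleChart.jetPoint_transition hp]
    exact BundleChart.mem_overlap hp.2 (c.total.map_target hp.1)
  have h4 := (BundleChart.contDiffAt_transition h3).comp p h2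
  exact contDiffAt_pi.1 h4.snd (Fin.last (k + 1))

/-- The affine bundle `J^{k+1} Y → J^k Y` has a smooth global section. It is glued from sections
over the domains of bundle charts by means of a partition of unity on `Y`. -/
theorem exists_isSmoothJetSection [FiniteDimensional ℝ EY] [IsManifold 𝓘(ℝ, EY) ∞ Y]
    [T2Space Y] [SigmaCompactSpace Y]
    (hch : ∀ y : Y, ∃ c : BundleChart EX EY EF π, y ∈ c.total.source) (k : ℕ) :
    ∃ Γ : Jet EX EY EF π k → Jet EX EY EF π (k + 1), IsSmoothJetSection Γ := by
  choose ch hch using hch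
  obtain ⟨ρ, hρ⟩ := SmoothPartitionOfUnity.exists_isSubordinate 𝓘(ℝ, EY) (s := (univ : Set Y))
    isClosed_univ (fun y => (ch y).total.source) (fun y => (ch y).total.open_source)
    fun y _ => mem_iUnion.2 ⟨y, hch y⟩
  -- Outside the chart domain any lift will do, because the weight of that chart vanishes there.
  have hZ : ∀ (y : Y) (j : Jet EX EY EF π k), ∃ J : Jet EX EY EF π (k + 1), J.proj = j ∧
      (j.eval ∈ (ch y).total.source → J.topCoord (ch y) = 0) := by
    intro y j
    by_cases h : j.eval ∈ (ch y).total.source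
    · obtain ⟨J, hJ, hJ0⟩ := exists_topCoord_eq_zero h
      exact ⟨J, hJ, fun _ => hJ0⟩
    · obtain ⟨J, hJ, _⟩ := exists_topCoord_eq_zero (hch j.eval)
      exact ⟨J, hJ, fun h' => (h h').elim⟩
  choose Z hZp hZ0 using hZ
  have hΓ : ∀ j : Jet EX EY EF π k, _ := fun j =>
    exists_affineCombination (ρ.finsupport j.eval) (fun i => ρ i j.eval)
      (ρ.sum_finsupport _ (mem_univ _)) (hch j.eval) (J := fun i => Z i j) fun i _ => hZp i j
  choose Γ hΓp hΓt using hΓ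
  let top (c : BundleChart EX EY EF π) (p : JetCoord EX EF k) :
      ContinuousMultilinearMap ℝ (fun _ : Fin (k + 1) => EX) EF :=
    ∑ᶠ i, ρ i (c.total.symm (jetPoint p)) • zeroTopCoord (ch i) c p
  have hcoord : ∀ c : BundleChart EX EY EF π, ∀ j : Jet EX EY EF π k, j.eval ∈ c.total.source →
      (Γ j).coord c = jetExtend (j.coord c) (top c (j.coord c)) := by
    intro c j hj
    rw [coord_eq_jetExtend, hΓp, hΓt j c hj]
    congr 1
    simp only [top]
    rw [jetPoint_coord hj, c.total.left_inv hj,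
      ← ρ.sum_finsupport_smul_eq_finsum j.eval fun i _ => zeroTopCoord (ch i) c (j.coord c)]
    refine Finset.sum_congr rfl fun i hi => ?_
    have hi' : j.eval ∈ (ch i).total.source :=
      hρ i (subset_closure ((ρ.mem_finsupport j.eval).1 hi))
    have he : (Z i j).eval = j.eval := by rw [← proj_eval, hZp]
    rw [topCoord_eq_zeroTopCoord (he ▸ hi') (he ▸ hj) (hZ0 i j hi'), hZp]
  have hsmooth : ∀ c : BundleChart EX EY EF π, ∀ p ∈ c.jetTarget k,
      ContDiffAt ℝ ∞ (fun p => jetExtend p (top c p)) p := by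
    intro c p₀ hp₀
    have hp : jetPoint p₀ ∈ c.total.target := hp₀
    refine (contDiff_jetExtend k).contDiffAt.comp p₀ (contDiffAt_id.prodMk ?_)
    set y₀ := c.total.symm (jetPoint p₀)
    have hσ : ContinuousAt (fun p : JetCoord EX EF k => c.total.symm (jetPoint p)) p₀ :=
      ContinuousAt.comp (g := c.total.symm) (c.total.continuousAt_symm hp)
        (BundleChart.contDiff_jetPoint k).continuous.continuousAt
    -- Near `p₀` only the finitely many indices whose closed support contains `y₀` contribute, and
    -- by subordination `y₀` lies in each of their chart domains, where `zeroTopCoord` is smooth.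
    have hfin : ContDiffAt ℝ ∞ (fun p => ∑ i ∈ ρ.fintsupport y₀,
        ρ i (c.total.symm (jetPoint p)) • zeroTopCoord (ch i) c p) p₀ := by
      refine ContDiffAt.sum fun i hi => ?_
      have hi' : y₀ ∈ (ch i).total.source := hρ i ((ρ.mem_fintsupport_iff y₀ i).1 hi)
      have h1 : ContDiffAt ℝ ∞ (fun q => ρ i (c.total.symm q)) (jetPoint p₀) := by
        rw [← contMDiffAt_iff_contDiffAt]
        exact (ρ i).contMDiff.contMDiffAt.comp (jetPoint p₀)
          (c.total_symm_smooth.contMDiffAt (c.total.open_target.mem_nhds hp))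
      exact (h1.comp p₀ (BundleChart.contDiff_jetPoint k).contDiffAt).smul
        (contDiffAt_zeroTopCoord ⟨hp, hi'⟩)
    refine hfin.congr_of_eventuallyEq ?_
    filter_upwards [hσ.eventually (ρ.eventually_finsupport_subset y₀)] with p hpe
    refine finsum_eq_sum_of_support_subset _ fun i hi => hpe ?_
    rw [ρ.mem_finsupport]
    intro h
    exact hi (by simp [h])
  have heval : ∀ j, (Γ j).eval = j.eval := fun j => by rw [← proj_eval, hΓp]
  refine ⟨Γ, ⟨hΓp, continuous_iff_continuousAt.2 fun j => ?_⟩, fun c =>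
    ⟨fun p => jetExtend p (top c p), fun p hp => (hsmooth c p hp).contDiffWithinAt, hcoord c⟩⟩
  have hj := hch j.eval
  refine continuousAt_of_coord (c := ch j.eval) (by rwa [heval]) ?_ ?_
  · simp only [heval]
    exact continuousAt_eval hj
  · have hp : j.coord (ch j.eval) ∈ (ch j.eval).jetTarget k := by
      change jetPoint (j.coord (ch j.eval)) ∈ (ch j.eval).total.target
      rw [jetPoint_coord hj]
      exact (ch j.eval).total.map_source hj
    refine (ContinuousAt.comp (f := fun j' : Jet EX EY EF π k => j'.coord (ch j.eval))
      (hsmooth (ch j.eval) _ hp).continuousAt (continuousAt_coord hj)).congr ?_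
    filter_upwards [eventually_eval_mem hj] with j' hj'
    exact (hcoord _ j' hj').symm

end Jet

end

/-! ### Step functions -/

/-- There are smooth step functions. -/
theorem exists_smooth_isStepFamily :
    ∃ f : ℕ → ℝ → ℝ, IsStepFamily f ∧ ∀ k, ContDiff ℝ ∞ (f k) := by
  -- The transition interval has length 2^{-(k+1)}; the factor stretches it to length 1.
  have hs : ∀ k : ℕ, ContDiff ℝ ∞ (fun t : ℝ =>
      Real.smoothTransition ((t - (1 - (1 / 2) ^ k)) * 2 ^ (k + 1))) := fun k =>
    Real.smoothTransition.contDiff.comp (by fun_prop)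
  refine ⟨_, ⟨fun k _ => (hs k).continuous.continuousOn, fun k _ t _ ht => ?_,
    fun k _ t _ ht => ?_⟩, hs⟩
  · exact Real.smoothTransition.zero_of_nonpos
      (mul_nonpos_of_nonpos_of_nonneg (by linarith) (by positivity))
  · refine Real.smoothTransition.one_of_one_le ?_
    have h2 : ((1 : ℝ) / 2) ^ (k + 1) * 2 ^ (k + 1) = 1 := by
      rw [← mul_pow]; norm_num
    have h3 : (1 / 2 : ℝ) ^ (k + 1) ≤ t - (1 - (1 / 2) ^ k) := by
      have : (1 / 2 : ℝ) ^ (k + 1) = (1 / 2) ^ k / 2 := by ring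
      linarith
    calc (1 : ℝ) = (1 / 2) ^ (k + 1) * 2 ^ (k + 1) := h2.symm
      _ ≤ _ := mul_le_mul_of_nonneg_right h3 (by positivity)

/-- The steps happen one after another: that of order `k + 1` begins only when those of orders `1,
…, k` are complete. This puts the two jets to be combined into one fibre. -/
theorem IsStepFamily.eq_one_of_ne_zero {f : ℕ → ℝ → ℝ} (hf : IsStepFamily f) {t : ℝ}
    (ht : t ∈ Icc (0 : ℝ) 1) {k m : ℕ} (hm : 1 ≤ m) (hmk : m ≤ k) (h : f (k + 1) t ≠ 0) :
    f m t = 1 := by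
  have h1 : 1 - (1 / 2 : ℝ) ^ (k + 1) < t := by
    by_contra! h'
    exact h (hf.eq_zero (k + 1) (by omega) t ht h')
  refine hf.eq_one m hm t ht (le_trans ?_ h1.le)
  have : (1 / 2 : ℝ) ^ (k + 1) ≤ (1 / 2) ^ (m + 1) :=
    pow_le_pow_of_le_one (by norm_num) (by norm_num) (by omega)
  linarith

/-! ### The deformation retraction -/

section

variable {EX EY EF : Type*}
  [NormedAddCommGroup EX] [NormedSpace ℝ EX] [NormedAddCommGroup EY] [NormedSpace ℝ EY]
  [NormedAddCommGroup EF] [NormedSpace ℝ EF]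
  {X Y : Type*} [TopologicalSpace X] [ChartedSpace EX X]
  [TopologicalSpace Y] [ChartedSpace EY Y] {π : Y → X}

theorem JetInf.eval_apply (q : JetInf EX EY EF π) (k : ℕ) : (q.1 k).eval = q.eval := by
  induction k with
  | zero => rfl
  | succ k ih => rw [← Jet.proj_eval, q.2 k, ih]

theorem IsContinuousJetSection.eval_apply {k : ℕ} {Γ : Jet EX EY EF π k → Jet EX EY EF π (k + 1)}
    (hΓ : IsContinuousJetSection Γ) (j : Jet EX EY EF π k) : (Γ j).eval = j.eval := by
  rw [← Jet.proj_eval, hΓ.proj_apply]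

namespace Jet

theorem continuousAt_topCoord {c : BundleChart EX EY EF π} {k : ℕ} {j : Jet EX EY EF π k}
    (hj : j.eval ∈ c.total.source) :
    ContinuousAt (fun j' : Jet EX EY EF π k => j'.topCoord c) j :=
  continuousAt_pi.1 (continuousAt_coord hj).snd (Fin.last k)

/-- Continuity of a map to `J^0 Y` amounts to that of the map to `Y`. -/
theorem continuousAt_of_eval {c : BundleChart EX EY EF π} {Z : Type*} [TopologicalSpace Z]
    {g : Z → Jet EX EY EF π 0} {z : Z} (hz : (g z).eval ∈ c.total.source)
    (he : ContinuousAt (fun w => (g w).eval) z) : ContinuousAt g z := by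
  refine continuousAt_of_coord hz he ?_
  have h1 : ContinuousAt (fun w => c.total (g w).eval) z :=
    ContinuousAt.comp (g := c.total) (c.total.continuousAt hz) he
  have h2 : ∀ᶠ w in 𝓝 z, jetPoint ((g w).coord c) = c.total (g w).eval := by
    filter_upwards [he.eventually (c.total.open_source.mem_nhds hz)] with w hw
    exact jetPoint_coord hw
  refine ContinuousAt.prodMk (f := fun w => ((g w).coord c).1) (g := fun w => ((g w).coord c).2)
    ?_ (continuousAt_pi.2 fun m => ?_)
  · refine h1.fst.congr ?_
    filter_upwards [h2] with w hw using (congrArg Prod.fst hw).symm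
  · obtain rfl : m = 0 := Fin.ext (by omega)
    have h3 : ContinuousAt
        (fun w => (continuousMultilinearCurryFin0 ℝ EX EF).symm (c.total (g w).eval).2) z :=
      ContinuousAt.comp (g := (continuousMultilinearCurryFin0 ℝ EX EF).symm)
        (LinearIsometryEquiv.continuous _).continuousAt h1.snd
    refine h3.congr ?_
    filter_upwards [h2] with w hw
    have h4 : (c.total (g w).eval).2 = ((g w).coord c).2 0 fun _ => 0 :=
      (congrArg Prod.snd hw).symm
    rw [h4]
    ext v
    have hv : v = fun _ => 0 := funext fun i => i.elim0
    rw [hv]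
    rfl

/-- The combination of two jets over the same jet of lower order. -/
theorem exists_comb (hch : ∀ y : Y, ∃ c : BundleChart EX EY EF π, y ∈ c.total.source) {k : ℕ}
    (a : ℝ) (J J' : Jet EX EY EF π (k + 1)) : ∃ K : Jet EX EY EF π (k + 1), K.proj = J'.proj ∧
      ∀ d : BundleChart EX EY EF π, J'.eval ∈ d.total.source → (a ≠ 0 → J.proj = J'.proj) →
        K.topCoord d = a • J.topCoord d + (1 - a) • J'.topCoord d := by
  obtain ⟨c, hc⟩ := hch J'.proj.eval
  by_cases h : J.proj = J'.proj
  · obtain ⟨K, hK, hKt⟩ := exists_affineCombination (Finset.univ : Finset Bool)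
      (fun b => if b then a else 1 - a) (by simp) hc (J := fun b => if b then J else J')
      (by rintro (_ | _) _ <;> simp [h])
    refine ⟨K, hK, fun d hd _ => ?_⟩
    rw [hKt d (by rwa [proj_eval])]
    simp
  -- Over different lower jets the formula is only claimed for weight `a = 0`, where it returns
  -- `J'`.
  · refine ⟨J', rfl, fun d _ ha => ?_⟩
    have : a = 0 := by
      by_contra h0
      exact h (ha h0)
    simp [this]

end Jet

/-- The recursion combines `q` with the section value one order at a time; `h_id` and
`IsStepFamily.eq_one_of_ne_zero` show that a nonzero weight occurs only when the two jets are over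
the same jet. -/
theorem exists_strongDeformationRetraction
    (hch : ∀ y : Y, ∃ c : BundleChart EX EY EF π, y ∈ c.total.source)
    {Γ : (k : ℕ) → Jet EX EY EF π k → Jet EX EY EF π (k + 1)}
    (hΓ : ∀ k, IsContinuousJetSection (Γ k)) {γ : Y → JetInf EX EY EF π}
    (hγ : ∀ y, (γ y).eval = y) (hγΓ : ∀ y k, (γ y).1 (k + 1) = Γ k ((γ y).1 k))
    {f : ℕ → ℝ → ℝ} (hf : IsStepFamily f) :
    ∃ H : I × JetInf EX EY EF π → JetInf EX EY EF π,
      IsStrongDeformationRetract γ JetInf.eval H ∧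
      (∀ t q, (H (t, q)).eval = q.eval) ∧
      ∀ (c : BundleChart EX EY EF π) (t : I) (q : JetInf EX EY EF π),
        q.eval ∈ c.total.source → ∀ k : ℕ,
          ((H (t, q)).1 (k + 1)).topCoord c =
            f (k + 1) t • (q.1 (k + 1)).topCoord c +
              (1 - f (k + 1) t) • (Γ k ((H (t, q)).1 k)).topCoord c := by
  have hcomb := fun k => Jet.exists_comb hch (k := k)
  choose comb hcp hct using hcomb
  let h : I × JetInf EX EY EF π → (k : ℕ) → Jet EX EY EF π k := fun w k =>
    Nat.rec (motive := fun k => Jet EX EY EF π k) (w.2.1 0)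
      (fun k j => comb k (f (k + 1) w.1) (w.2.1 (k + 1)) (Γ k j)) k
  have h_succ : ∀ w k, h w (k + 1) = comb k (f (k + 1) w.1) (w.2.1 (k + 1)) (Γ k (h w k)) :=
    fun _ _ => rfl
  have h_proj : ∀ w k, (h w (k + 1)).proj = h w k := fun w k => by
    rw [h_succ, hcp, (hΓ k).proj_apply]
  let H : I × JetInf EX EY EF π → JetInf EX EY EF π := fun w => ⟨h w, h_proj w⟩
  have h_eval : ∀ w k, (h w k).eval = w.2.eval := fun w k => (H w).eval_apply k
  -- where all the step functions of orders `≤ k` are `1`, nothing is changed up to order `k`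
  have h_id : ∀ w k, (∀ m, 1 ≤ m → m ≤ k → f m w.1 = 1) → h w k = w.2.1 k := by
    intro w k
    induction k with
    | zero => exact fun _ => rfl
    | succ k ih =>
      intro hw
      have ih := ih fun m h1 h2 => hw m h1 (by omega)
      obtain ⟨c, hc⟩ := hch w.2.eval
      have hΓe : (Γ k (h w k)).eval ∈ c.total.source := by
        rwa [(hΓ k).eval_apply, h_eval]
      refine Jet.ext_topCoord (c := c) (by rwa [h_eval]) (by rw [h_proj, ih, w.2.2]) ?_
      rw [h_succ, hct k _ _ _ c hΓe fun _ => by rw [(hΓ k).proj_apply, ih, w.2.2],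
        hw (k + 1) (by omega) le_rfl]
      simp
  have h_top : ∀ (c : BundleChart EX EY EF π) w, w.2.eval ∈ c.total.source → ∀ k,
      (h w (k + 1)).topCoord c = f (k + 1) w.1 • (w.2.1 (k + 1)).topCoord c +
        (1 - f (k + 1) w.1) • (Γ k (h w k)).topCoord c := by
    intro c w hw k
    rw [h_succ]
    refine hct k _ _ _ c (by rwa [(hΓ k).eval_apply, h_eval]) fun h0 => ?_
    rw [(hΓ k).proj_apply, w.2.2,
      h_id w k fun m h1 h2 => hf.eq_one_of_ne_zero w.1.2 h1 h2 h0]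
  -- Points of the limit are compared order by order: once the jets of order `k` agree, only the top
  -- coordinates of order `k + 1` remain. This serves `t = 0` and the points of the image of `γ`.
  have h_unique : ∀ w (r : JetInf EX EY EF π), r.eval = w.2.eval →
      (∀ k, h w k = r.1 k → ∀ c : BundleChart EX EY EF π, w.2.eval ∈ c.total.source →
        (h w (k + 1)).topCoord c = (r.1 (k + 1)).topCoord c) → H w = r := by
    intro w r hr hk
    obtain ⟨c, hc⟩ := hch w.2.eval
    refine Subtype.ext (funext fun k => ?_)
    change h w k = r.1 k
    induction k with
    | zero => exact Jet.ext_eval (c := c) (by rwa [h_eval]) hr.symm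
    | succ k ih =>
      exact Jet.ext_topCoord (c := c) (by rwa [h_eval]) (by rw [h_proj, r.2, ih]) (hk k ih c hc)
  have heval : Continuous (JetInf.eval : JetInf EX EY EF π → Y) := by
    refine continuous_iff_continuousAt.2 fun q => ?_
    obtain ⟨c, hc⟩ := hch q.eval
    exact ContinuousAt.comp (g := Jet.eval) (Jet.continuousAt_eval (c := c) hc)
      ((continuous_apply 0).comp continuous_subtype_val).continuousAt
  have hγc : Continuous γ := by
    refine Continuous.subtype_mk (continuous_pi fun k => ?_) _
    induction k with
    | zero =>
      refine continuous_iff_continuousAt.2 fun y => ?_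
      obtain ⟨c, hc⟩ := hch y
      have he : ∀ y, ((γ y).1 0).eval = y := hγ
      refine Jet.continuousAt_of_eval (c := c) (by rwa [he]) ?_
      simp only [he]
      exact continuousAt_id
    | succ k ih =>
      simp only [hγΓ]
      exact (hΓ k).continuous.comp ih
  have hcont : ∀ k, Continuous fun w => h w k := by
    intro k
    have hq : ∀ k, Continuous fun w : I × JetInf EX EY EF π => w.2.1 k := fun k =>
      (continuous_apply k).comp (continuous_subtype_val.comp continuous_snd)
    induction k with
    | zero => exact hq 0
    | succ k ih =>
      refine continuous_iff_continuousAt.2 fun w₀ => ?_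
      obtain ⟨c, hc⟩ := hch w₀.2.eval
      have he : Continuous fun w : I × JetInf EX EY EF π => w.2.eval := heval.comp continuous_snd
      refine Jet.continuousAt_of_coord (c := c) (by rwa [h_eval]) ?_ ?_
      · simp only [h_eval]
        exact he.continuousAt
      · have hfc : Continuous fun w : I × JetInf EX EY EF π => f (k + 1) w.1 :=
          (hf.continuousOn (k + 1) (by omega)).comp_continuous
            (continuous_subtype_val.comp continuous_fst) fun w => w.1.2
        have h1 : ContinuousAt (fun w => (h w k).coord c) w₀ :=
          ContinuousAt.comp (g := fun j : Jet EX EY EF π k => j.coord c)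
            (Jet.continuousAt_coord (by rwa [h_eval])) ih.continuousAt
        have h2 : ContinuousAt (fun w => (w.2.1 (k + 1)).topCoord c) w₀ :=
          ContinuousAt.comp (g := fun j : Jet EX EY EF π (k + 1) => j.topCoord c)
            (Jet.continuousAt_topCoord (by rwa [JetInf.eval_apply])) (hq (k + 1)).continuousAt
        have h3 : ContinuousAt (fun w => (Γ k (h w k)).topCoord c) w₀ :=
          ContinuousAt.comp (g := fun j : Jet EX EY EF π (k + 1) => j.topCoord c)
            (Jet.continuousAt_topCoord (by rwa [(hΓ k).eval_apply, h_eval]))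
            ((hΓ k).continuous.comp ih).continuousAt
        have h4 := (hfc.continuousAt.smul h2).add
          (((continuous_const (y := (1 : ℝ))).sub hfc).continuousAt.smul h3)
        refine (ContinuousAt.comp (f := fun w => ((h w k).coord c, _))
          (contDiff_jetExtend k).continuous.continuousAt (h1.prodMk h4)).congr ?_
        filter_upwards [he.continuousAt.eventually (c.total.open_source.mem_nhds hc)] with w hw
        rw [Jet.coord_eq_jetExtend, h_proj, h_top c w hw]
        rfl
  refine ⟨H, ⟨.of_leftInverse hγ heval hγc, heval, hγ,
    Continuous.subtype_mk (continuous_pi hcont) _, fun q => ?_, fun q => ?_, fun t y => ?_⟩,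
    fun t q => rfl, fun c t q hq k => h_top c (t, q) hq k⟩
  · refine h_unique _ _ (hγ _) fun k hk c hc => ?_
    have h0 : f (k + 1) ((0 : I) : ℝ) = 0 :=
      hf.eq_zero (k + 1) (by omega) _ (0 : I).2 (by
        have := pow_le_one₀ (n := k + 1) (by norm_num : (0 : ℝ) ≤ 1 / 2) (by norm_num)
        rw [Set.Icc.coe_zero]
        linarith)
    rw [h_top c _ hc, hk, hγΓ, h0]
    simp
  · refine Subtype.ext (funext fun k => h_id _ k fun m hm _ => ?_)
    refine hf.eq_one m hm _ (1 : I).2 ?_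
    rw [Set.Icc.coe_one]
    have : (0 : ℝ) ≤ (1 / 2) ^ (m + 1) := by positivity
    linarith
  -- On the image of `γ` both jets being combined are equal, and the weights sum to 1.
  · refine h_unique _ _ rfl fun k hk c hc => ?_
    rw [h_top c _ hc, hk, ← hγΓ, ← add_smul]
    simp

end

end

theorem mainTheorem1
    {EX EY EF X Y F : Type*}
    [NormedAddCommGroup EX] [NormedSpace ℝ EX] [FiniteDimensional ℝ EX]
    [NormedAddCommGroup EY] [NormedSpace ℝ EY] [FiniteDimensional ℝ EY]
    [NormedAddCommGroup EF] [NormedSpace ℝ EF] [FiniteDimensional ℝ EF]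
    [TopologicalSpace X] [ChartedSpace EX X] [IsManifold 𝓘(ℝ, EX) ∞ X]
    [T2Space X] [ParacompactSpace X] [ConnectedSpace X]
    [TopologicalSpace Y] [ChartedSpace EY Y] [IsManifold 𝓘(ℝ, EY) ∞ Y]
    [T2Space Y] [ParacompactSpace Y] [ConnectedSpace Y]
    [TopologicalSpace F] [ChartedSpace EF F] [IsManifold 𝓘(ℝ, EF) ∞ F]
    (π : Y → X) (hπ : IsSmoothFibreBundle EX EY EF F π) :
    -- the affine jet bundles have smooth global sections
    (∀ k, ∃ Γ : Jet EX EY EF π k → Jet EX EY EF π (k + 1), IsSmoothJetSection Γ) ∧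
    -- there are step functions, even smooth ones
    (∃ f : ℕ → ℝ → ℝ, IsStepFamily f ∧ ∀ k, ContDiff ℝ ∞ (f k)) ∧
    -- and any choice of sections and step functions gives a strong deformation retraction
    ∀ Γ : (k : ℕ) → Jet EX EY EF π k → Jet EX EY EF π (k + 1),
      (∀ k, IsContinuousJetSection (Γ k)) →
      ∃ γ : Y → JetInf EX EY EF π,
        (∀ y, (γ y).eval = y) ∧
        (∀ y k, (γ y).1 (k + 1) = Γ k ((γ y).1 k)) ∧
        ∀ f : ℕ → ℝ → ℝ, IsStepFamily f →
          ∃ H : I × JetInf EX EY EF π → JetInf EX EY EF π,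
            IsStrongDeformationRetract γ JetInf.eval H ∧
            (∀ t q, (H (t, q)).eval = q.eval) ∧
            ∀ (c : BundleChart EX EY EF π) (t : I) (q : JetInf EX EY EF π),
              q.eval ∈ c.total.source → ∀ k : ℕ,
                ((H (t, q)).1 (k + 1)).topCoord c =
                  f (k + 1) t • (q.1 (k + 1)).topCoord c +
                    (1 - f (k + 1) t) • (Γ k ((H (t, q)).1 k)).topCoord c := by
  have hch : ∀ y : Y, ∃ c : BundleChart EX EY EF π, y ∈ c.total.source := hπ.exists_bundleChart
  have : LocallyCompactSpace Y := ChartedSpace.locallyCompactSpace EY Y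
  have : SigmaCompactSpace Y := sigmaCompactSpace_of_paracompact_connected Y
  refine ⟨Jet.exists_isSmoothJetSection hch, exists_smooth_isStepFamily, fun Γ hΓ => ?_⟩
  choose c hc using hch
  choose j₀ hj₀ using fun y => Jet.exists_eval_eq (hc y)
  -- The sections are iterated from the jet of order zero with value `y`.
  let γ : Y → JetInf EX EY EF π := fun y =>
    ⟨fun k => Nat.rec (motive := fun k => Jet EX EY EF π k) (j₀ y) Γ k,
      fun k => (hΓ k).proj_apply _⟩
  exact ⟨γ, hj₀, fun _ _ => rfl, fun f hf =>
    exists_strongDeformationRetraction (γ := γ) (fun y => ⟨c y, hc y⟩) hΓ hj₀ (fun _ _ => rfl) hf⟩
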